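/- **Proposition (Ghioca–Tucker counterexample).** Let $E$ be the elliptic curve $y^2=x^3-x$ over $\mathbf C$, with origin $0$ the point at infinity. Put $[i](x,y)=(-x,iy)$, $[i](0)=0$, and for $a=m+ni\in\mathbf Z[i]$ put $[a]P=mP+n\,[i]P$. The map $[i]$ is a morphism of varieties, and $a\mapsto[a]$ is an injective ring homomorphism from $\mathbf Z[i]$ to the endomorphisms of the group $E(\mathbf C)$ (so $E$ has complex multiplication). Let $X=E\times E$, let $\mathscr L=\mathscr O_X(0\times E+E\times 0)$, and let $f=([3+4i],[5])\colon X\to X$, $f(P,Q)=([3+4i]P,[5]Q)$. Recall that a polarized dynamical system of weight $d$, where $d\ge 2$ is an integer, is a triple $(X,f,\mathscr L)$ consisting of an integral projective variety $X$, a morphism $f\colon X\to X$ and an ample line bundle $\mathscr L$ on $X$ such that $f^*\mathscr L\simeq\mathscr L^{d}$. A point is preperiodic if one of its iterates under $f$ is periodic. A subvariety $Y$ is preperiodic if the sequence $(f^n(Y))_{n\ge0}$ has only finitely many distinct terms. Then: 1. $f$ is a morphism, $|3+4i|^2=5^2$, and $(X,f,\mathscr L)$ is a polarized dynamical system of weight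 $25$; 2. the diagonal of $X$ is an irreducible closed subvariety which contains infinitely many preperiodic points of $f$, but it is not a preperiodic subvariety; 3. the complex number $(3+4i)/5$ is not a root of unity; 4. consequently the dynamical Manin–Mumford question has a negative answer. That question asks whether, for every polarized dynamical system $(X,f,\mathscr L)$ over an algebraically closed field of characteristic zero and every irreducible closed subvariety $Y\subseteq X$, the irreducible components of the Zariski closure of the set of preperiodic points lying on $Y$ are all preperiodic subvarieties. It fails for the system $(X,f,\mathscr L)$ above with $Y$ the diagonal. -/

import Mathlib

open Complex
open scoped Topology LinearAlgebra.Projectivization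

noncomputable section

/-! ## Classical projective varieties over a field -/

/-- A set `pts` together with a map to the projective space `ℙ(k^σ)`, given by a choice of
homogeneous coordinates for every point. -/
structure ProjModel (k : Type) [Field k] where
  pts : Type
  σ : Type
  [fintype : Fintype σ]
  coord : pts → σ → k
  coord_ne_zero : ∀ x, coord x ≠ 0

namespace ProjModel

variable {k : Type} [Field k]

/-- The point of projective space with homogeneous coordinates `X.coord x`. -/
def point (X : ProjModel k) (x : X.pts) : ℙ k (X.σ → k) :=
  Projectivization.mk k (X.coord x) (X.coord_ne_zero x)

/-- The Zariski topology: the sets `{p ≠ 0}`, for `p` a homogeneous polynomial in the homogeneous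
coordinates, form a base of open sets. -/
abbrev zariski (X : ProjModel k) : TopologicalSpace X.pts :=
  TopologicalSpace.generateFrom
    {U | ∃ (d : ℕ) (p : MvPolynomial X.σ k), p.IsHomogeneous d ∧
      U = {x | MvPolynomial.eval (X.coord x) p ≠ 0}}

/-- Open subset for the Zariski topology. -/
def Open (X : ProjModel k) (U : Set X.pts) : Prop := IsOpen[X.zariski] U

/-- Closed subset for the Zariski topology. -/
def Closed (X : ProjModel k) (Z : Set X.pts) : Prop := IsClosed[X.zariski] Z

/-- Irreducible (in particular nonempty) subset for the Zariski topology. -/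
def Irred (X : ProjModel k) (Z : Set X.pts) : Prop := @IsIrreducible X.pts X.zariski Z

/-- Closure for the Zariski topology. -/
def zariskiClosure (X : ProjModel k) (Z : Set X.pts) : Set X.pts := closure[X.zariski] Z

/-- `Z` is an irreducible component of the subset `Y`. -/
def IsComponent (X : ProjModel k) (Z Y : Set X.pts) : Prop :=
  Maximal (fun T => X.Irred T ∧ T ⊆ Y) Z

/-- The subset of `ℙ(k^σ)` defined by a set of (homogeneous) polynomials. -/
def zeroLocus {σ : Type} (S : Set (MvPolynomial σ k)) : Set (ℙ k (σ → k)) :=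
  {v | ∀ p ∈ S, MvPolynomial.eval v.rep p = 0}

/-- `X` is (through its map to projective space) an irreducible closed subvariety of `ℙ(k^σ)`. -/
structure IsProjectiveVariety (X : ProjModel k) : Prop where
  injective : Function.Injective X.point
  closed : ∃ S : Set (MvPolynomial X.σ k),
    (∀ p ∈ S, ∃ d : ℕ, p.IsHomogeneous d) ∧ Set.range X.point = zeroLocus S
  irreducible : X.Irred Set.univ

/-- The function `φ` is regular at `x`: in a neighbourhood of `x`, it is a quotient of two
homogeneous polynomials of the same degree. Only the values of `φ` near `x` matter. -/
def RegularAt (X : ProjModel k) (φ : X.pts → k) (x : X.pts) : Prop :=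
  ∃ (d : ℕ) (p q : MvPolynomial X.σ k), p.IsHomogeneous d ∧ q.IsHomogeneous d ∧
    ∃ U : Set X.pts, X.Open U ∧ x ∈ U ∧ ∀ y ∈ U, MvPolynomial.eval (X.coord y) q ≠ 0 ∧
      φ y = MvPolynomial.eval (X.coord y) p / MvPolynomial.eval (X.coord y) q

/-- A morphism of varieties: a continuous map that pulls regular functions back to regular
functions. -/
structure Hom (X Y : ProjModel k) where
  toFun : X.pts → Y.pts
  continuous' : ∀ U : Set Y.pts, Y.Open U → X.Open (toFun ⁻¹' U)
  regular' : ∀ (x : X.pts) (φ : Y.pts → k), Y.RegularAt φ (toFun x) →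
    X.RegularAt (fun z => φ (toFun z)) x

/-- An isomorphism of varieties. -/
structure Iso (X Y : ProjModel k) where
  hom : Hom X Y
  inv : Hom Y X
  left_inv : ∀ x, inv.toFun (hom.toFun x) = x
  right_inv : ∀ y, hom.toFun (inv.toFun y) = y

theorem Open.inter {X : ProjModel k} {U V : Set X.pts} (hU : X.Open U) (hV : X.Open V) :
    X.Open (U ∩ V) :=
  @IsOpen.inter _ X.zariski U V hU hV

theorem open_ne {X : ProjModel k} {d : ℕ} {p : MvPolynomial X.σ k} (hp : p.IsHomogeneous d) :
    X.Open {x | MvPolynomial.eval (X.coord x) p ≠ 0} :=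
  TopologicalSpace.isOpen_generateFrom_of_mem ⟨d, p, hp, rfl⟩

theorem open_iUnion {X : ProjModel k} {ι : Type} {U : ι → Set X.pts}
    (h : ∀ i, X.Open (U i)) : X.Open (⋃ i, U i) :=
  @isOpen_iUnion _ _ X.zariski U h

theorem open_univ (X : ProjModel k) : X.Open Set.univ := @isOpen_univ _ X.zariski

theorem RegularAt.mul {X : ProjModel k} {φ ψ : X.pts → k} {x : X.pts}
    (hφ : X.RegularAt φ x) (hψ : X.RegularAt ψ x) :
    X.RegularAt (fun y => φ y * ψ y) x := by
  obtain ⟨d, p, q, hp, hq, U, hU, hx, h⟩ := hφ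
  obtain ⟨e, r, s, hr, hs, V, hV, hx', h'⟩ := hψ
  refine ⟨d + e, p * r, q * s, hp.mul hr, hq.mul hs, U ∩ V, hU.inter hV, ⟨hx, hx'⟩, ?_⟩
  rintro y ⟨hy, hy'⟩
  rw [map_mul, map_mul]
  exact ⟨mul_ne_zero (h y hy).1 (h' y hy').1, by
    beta_reduce
    rw [(h y hy).2, (h' y hy').2, div_mul_div_comm]⟩

theorem RegularAt.pow {X : ProjModel k} {φ : X.pts → k} {x : X.pts}
    (hφ : X.RegularAt φ x) (n : ℕ) : X.RegularAt (fun y => φ y ^ n) x := by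
  obtain ⟨d, p, q, hp, hq, U, hU, hx, h⟩ := hφ
  refine ⟨d * n, p ^ n, q ^ n, hp.pow n, hq.pow n, U, hU, hx, ?_⟩
  intro y hy
  rw [map_pow, map_pow]
  exact ⟨pow_ne_zero _ (h y hy).1, by
    beta_reduce
    rw [(h y hy).2, div_pow]⟩

theorem regularAt_const (X : ProjModel k) (c : k) (x : X.pts) :
    X.RegularAt (fun _ => c) x := by
  refine ⟨0, MvPolynomial.C c, 1, MvPolynomial.isHomogeneous_C _ _,
    MvPolynomial.isHomogeneous_one _ _, Set.univ, X.open_univ, trivial, ?_⟩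
  intro y _
  simp

theorem regularAt_coord_div (X : ProjModel k) (i j : X.σ) {x : X.pts} (hx : X.coord x i ≠ 0) :
    X.RegularAt (fun y => X.coord y j / X.coord y i) x := by
  refine ⟨1, MvPolynomial.X j, MvPolynomial.X i, MvPolynomial.isHomogeneous_X _ _,
    MvPolynomial.isHomogeneous_X _ _, _, open_ne (MvPolynomial.isHomogeneous_X k i), ?_, ?_⟩
  · simpa using hx
  · intro y hy
    exact ⟨hy, by simp⟩

/-! ### Line bundles -/

/-- A line bundle, given by trivializations over an open cover `U i` and its transition functions:
a section is a family of functions `s i` on `U i` with `s i = g i j * s j` on `U i ∩ U j`.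
Values of `g i j` outside `U i ∩ U j` are irrelevant. -/
structure LineBundle (X : ProjModel k) where
  ι : Type
  U : ι → Set X.pts
  isOpen : ∀ i, X.Open (U i)
  cover : ∀ x, ∃ i, x ∈ U i
  g : ι → ι → X.pts → k
  regular : ∀ i j x, x ∈ U i → x ∈ U j → X.RegularAt (g i j) x
  self : ∀ i x, x ∈ U i → g i i x = 1
  cocycle : ∀ i j l x, x ∈ U i → x ∈ U j → x ∈ U l → g i j x * g j l x = g i l x

namespace LineBundle

variable {X Y : ProjModel k}

/-- An isomorphism of line bundles: the section of `L` with local expressions `s a` is sent to the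
section of `M` with local expressions `h a i * s a`. -/
structure Iso (L M : LineBundle X) where
  h : L.ι → M.ι → X.pts → k
  regular : ∀ a i x, x ∈ L.U a → x ∈ M.U i → X.RegularAt (h a i) x
  ne_zero : ∀ a i x, x ∈ L.U a → x ∈ M.U i → h a i x ≠ 0
  compat : ∀ a b i j x, x ∈ L.U a → x ∈ L.U b → x ∈ M.U i → x ∈ M.U j →
    h b j x = M.g j i x * h a i x * L.g a b x

/-- The tensor product of two line bundles. -/
def tensor (L M : LineBundle X) : LineBundle X where
  ι := L.ι × M.ι
  U a := L.U a.1 ∩ M.U a.2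
  isOpen a := (L.isOpen a.1).inter (M.isOpen a.2)
  cover x := by
    obtain ⟨i, hi⟩ := L.cover x
    obtain ⟨j, hj⟩ := M.cover x
    exact ⟨(i, j), hi, hj⟩
  g a b x := L.g a.1 b.1 x * M.g a.2 b.2 x
  regular a b x ha hb := (L.regular _ _ x ha.1 hb.1).mul (M.regular _ _ x ha.2 hb.2)
  self a x ha := by rw [L.self _ x ha.1, M.self _ x ha.2, mul_one]
  cocycle a b c x ha hb hc := by
    rw [mul_mul_mul_comm, L.cocycle _ _ _ x ha.1 hb.1 hc.1, M.cocycle _ _ _ x ha.2 hb.2 hc.2]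

/-- The tensor power `L ^ n` of a line bundle. -/
def pow (L : LineBundle X) (n : ℕ) : LineBundle X where
  ι := L.ι
  U := L.U
  isOpen := L.isOpen
  cover := L.cover
  g i j x := L.g i j x ^ n
  regular i j x hi hj := (L.regular i j x hi hj).pow n
  self i x hi := by rw [L.self i x hi, one_pow]
  cocycle i j l x hi hj hl := by rw [← mul_pow, L.cocycle i j l x hi hj hl]

/-- The pullback of a line bundle by a morphism. -/
def pullback (f : Hom X Y) (L : LineBundle Y) : LineBundle X where
  ι := L.ι
  U i := f.toFun ⁻¹' L.U i
  isOpen i := f.continuous' _ (L.isOpen i)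
  cover x := L.cover (f.toFun x)
  g i j x := L.g i j (f.toFun x)
  regular i j x hi hj := f.regular' x _ (L.regular i j _ hi hj)
  self i _ hi := L.self i _ hi
  cocycle i j l _ hi hj hl := L.cocycle i j l _ hi hj hl

/-- The line bundle `𝒪(1)` of a variety in projective space, trivialized over `{X_i ≠ 0}` by its
section `X_i`. -/
def hyperplane (X : ProjModel k) : LineBundle X where
  ι := X.σ
  U i := {x | X.coord x i ≠ 0}
  isOpen i := by
    simpa using open_ne (X := X) (MvPolynomial.isHomogeneous_X k i)
  cover x := Function.ne_iff.mp (X.coord_ne_zero x)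
  g i j x := X.coord x j / X.coord x i
  regular i j _ hi _ := X.regularAt_coord_div i j hi
  self _ _ hi := div_self hi
  cocycle i j l x hi hj _ := by
    have hi' : X.coord x i ≠ 0 := hi
    have hj' : X.coord x j ≠ 0 := hj
    field_simp

/-- `L` is very ample: it is isomorphic to the pullback of `𝒪(1)` by an isomorphism from `X` to a
closed subvariety `P` of a projective space. -/
def IsVeryAmple (L : LineBundle X) : Prop :=
  ∃ P : ProjModel k, P.IsProjectiveVariety ∧ ∃ φ : ProjModel.Iso X P,
    Nonempty (Iso (pullback φ.hom (hyperplane P)) L)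

/-- `L` is ample: some positive power of `L` is very ample. -/
def IsAmple (L : LineBundle X) : Prop := ∃ m : ℕ, 1 ≤ m ∧ (L.pow m).IsVeryAmple

end LineBundle

/-! ### Polarized dynamical systems -/

/-- `(X, f, L)` is a polarized dynamical system of weight `d`: `X` is an integral projective
variety, `L` is an ample line bundle on `X`, `d ≥ 2` and `f^* L ≅ L ^ d`. -/
structure IsPolarizedOfWeight {X : ProjModel k} (f : Hom X X) (L : LineBundle X) (d : ℕ) :
    Prop where
  variety : X.IsProjectiveVariety
  ample : L.IsAmple
  two_le : 2 ≤ d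
  iso : Nonempty (LineBundle.Iso (LineBundle.pullback f L) (L.pow d))

/-- The preperiodic points of a self-map: those with an iterate that is periodic. -/
def preperiodicPoints {S : Type} (f : S → S) : Set S :=
  {x | ∃ n : ℕ, f^[n] x ∈ Function.periodicPts f}

/-- The subvariety `Y` is preperiodic: the sequence `f^n(Y)` has finitely many distinct terms. -/
def IsPreperiodicSubvariety {S : Type} (f : S → S) (Y : Set S) : Prop :=
  (Set.range fun n : ℕ => f^[n] '' Y).Finite

/-- The statement asked by the dynamical Manin–Mumford question for `(X, f)` and a subvariety `Y`:
every irreducible component of the Zariski closure of the set of preperiodic points of `X` that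
lie on `Y` is a preperiodic subvariety. -/
def ManinMumfordFor {X : ProjModel k} (f : Hom X X) (Y : Set X.pts) : Prop :=
  ∀ Z : Set X.pts, X.IsComponent Z (X.zariskiClosure (preperiodicPoints f.toFun ∩ Y)) →
    IsPreperiodicSubvariety f.toFun Z

/-! ### Products -/

/-- The product of two varieties, embedded by the Segre map `(v, w) ↦ (v_i w_j)`. -/
abbrev prod (X Y : ProjModel k) : ProjModel k where
  pts := X.pts × Y.pts
  σ := X.σ × Y.σ
  fintype := @instFintypeProd X.σ Y.σ X.fintype Y.fintype
  coord P a := X.coord P.1 a.1 * Y.coord P.2 a.2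
  coord_ne_zero P := by
    obtain ⟨i, hi⟩ := Function.ne_iff.mp (X.coord_ne_zero P.1)
    obtain ⟨j, hj⟩ := Function.ne_iff.mp (Y.coord_ne_zero P.2)
    exact Function.ne_iff.mpr ⟨(i, j), mul_ne_zero hi hj⟩

theorem eval_mul_right {σ : Type} {d : ℕ} {p : MvPolynomial σ k} (hp : p.IsHomogeneous d)
    (v : σ → k) (c : k) :
    MvPolynomial.eval (fun i => v i * c) p = c ^ d * MvPolynomial.eval v p := by
  rw [MvPolynomial.eval_eq, MvPolynomial.eval_eq, Finset.mul_sum]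
  refine Finset.sum_congr rfl fun m hm => ?_
  have hd : ∑ i ∈ m.support, m i = d := by
    have := hp (MvPolynomial.mem_support_iff.mp hm)
    rwa [Finsupp.weight_apply, Finsupp.sum, Finset.sum_congr rfl
      (fun i _ => by simp : ∀ i ∈ m.support, m i • (1 : σ → ℕ) i = m i)] at this
  simp only [mul_pow, Finset.prod_mul_distrib, Finset.prod_pow_eq_pow_sum, hd]
  ring

theorem eval_rename_fst (X Y : ProjModel k) {d : ℕ} {p : MvPolynomial X.σ k}
    (hp : p.IsHomogeneous d) (j : Y.σ) (P : X.pts × Y.pts) :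
    MvPolynomial.eval ((X.prod Y).coord P)
        (MvPolynomial.rename (fun i => ((i, j) : X.σ × Y.σ)) p) =
      Y.coord P.2 j ^ d * MvPolynomial.eval (X.coord P.1) p := by
  rw [MvPolynomial.eval_rename, ← eval_mul_right hp]
  rfl

theorem eval_rename_snd (X Y : ProjModel k) {d : ℕ} {p : MvPolynomial Y.σ k}
    (hp : p.IsHomogeneous d) (i : X.σ) (P : X.pts × Y.pts) :
    MvPolynomial.eval ((X.prod Y).coord P)
        (MvPolynomial.rename (fun j => ((i, j) : X.σ × Y.σ)) p) =
      X.coord P.1 i ^ d * MvPolynomial.eval (Y.coord P.2) p := by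
  rw [MvPolynomial.eval_rename, ← eval_mul_right hp]
  congr 2
  funext j
  exact mul_comm _ _

/-- Continuity for the Zariski topology can be tested on the basic open sets. -/
theorem continuous_of_basic {X Y : ProjModel k} (f : X.pts → Y.pts)
    (h : ∀ (d : ℕ) (p : MvPolynomial Y.σ k), p.IsHomogeneous d →
      X.Open {x | MvPolynomial.eval (Y.coord (f x)) p ≠ 0})
    (U : Set Y.pts) (hU : Y.Open U) : X.Open (f ⁻¹' U) := by
  let _ := X.zariski
  let _ := Y.zariski
  have hc : Continuous f := by
    refine continuous_generateFrom_iff.mpr ?_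
    rintro _ ⟨d, p, hp, rfl⟩
    exact h d p hp
  exact hc.isOpen_preimage U hU

theorem fst_continuous (X Y : ProjModel k) (U : Set X.pts) (hU : X.Open U) :
    (X.prod Y).Open ((fun P : X.pts × Y.pts => P.1) ⁻¹' U) := by
  refine continuous_of_basic (X := X.prod Y) (Y := X) _ (fun d p hp => ?_) U hU
  have key := open_iUnion (X := X.prod Y) (ι := Y.σ) fun j =>
    open_ne (X := X.prod Y)
      (hp.rename_isHomogeneous (f := fun i => ((i, j) : X.σ × Y.σ)))
  convert key using 1
  ext P
  simp only [Set.mem_iUnion, Set.mem_ofPred_eq]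
  constructor
  · intro h
    obtain ⟨j, hj⟩ := Function.ne_iff.mp (Y.coord_ne_zero P.2)
    exact ⟨j, by rw [eval_rename_fst X Y hp]; exact mul_ne_zero (pow_ne_zero _ hj) h⟩
  · rintro ⟨j, hj⟩
    rw [eval_rename_fst X Y hp] at hj
    exact right_ne_zero_of_mul hj

theorem snd_continuous (X Y : ProjModel k) (U : Set Y.pts) (hU : Y.Open U) :
    (X.prod Y).Open ((fun P : X.pts × Y.pts => P.2) ⁻¹' U) := by
  refine continuous_of_basic (X := X.prod Y) (Y := Y) _ (fun d p hp => ?_) U hU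
  have key := open_iUnion (X := X.prod Y) (ι := X.σ) fun i =>
    open_ne (X := X.prod Y)
      (hp.rename_isHomogeneous (f := fun j => ((i, j) : X.σ × Y.σ)))
  convert key using 1
  ext P
  simp only [Set.mem_iUnion, Set.mem_ofPred_eq]
  constructor
  · intro h
    obtain ⟨i, hi⟩ := Function.ne_iff.mp (X.coord_ne_zero P.1)
    exact ⟨i, by rw [eval_rename_snd X Y hp]; exact mul_ne_zero (pow_ne_zero _ hi) h⟩
  · rintro ⟨i, hi⟩
    rw [eval_rename_snd X Y hp] at hi
    exact right_ne_zero_of_mul hi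

/-- The first projection. -/
def fst (X Y : ProjModel k) : Hom (X.prod Y) X where
  toFun := fun P => P.1
  continuous' := fst_continuous X Y
  regular' := by
    rintro P φ ⟨d, p, q, hp, hq, U, hU, hx, h⟩
    obtain ⟨j, hj⟩ := Function.ne_iff.mp (Y.coord_ne_zero P.2)
    have hqj := hq.rename_isHomogeneous (f := fun i => ((i, j) : X.σ × Y.σ))
    refine ⟨d, _, _, hp.rename_isHomogeneous (f := fun i => ((i, j) : X.σ × Y.σ)), hqj, _,
      (fst_continuous X Y U hU).inter (open_ne (X := X.prod Y) hqj), ⟨hx, ?_⟩, ?_⟩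
    · change MvPolynomial.eval _ _ ≠ 0
      rw [eval_rename_fst X Y hq]
      exact mul_ne_zero (pow_ne_zero _ hj) (h _ hx).1
    · rintro Q ⟨hQ, hQ'⟩
      refine ⟨hQ', ?_⟩
      change MvPolynomial.eval _ _ ≠ 0 at hQ'
      rw [eval_rename_fst X Y hq] at hQ'
      rw [eval_rename_fst X Y hq, eval_rename_fst X Y hp,
        mul_div_mul_left _ _ (left_ne_zero_of_mul hQ')]
      exact (h _ hQ).2

/-- The second projection. -/
def snd (X Y : ProjModel k) : Hom (X.prod Y) Y where
  toFun := fun P => P.2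
  continuous' := snd_continuous X Y
  regular' := by
    rintro P φ ⟨d, p, q, hp, hq, U, hU, hx, h⟩
    obtain ⟨i, hi⟩ := Function.ne_iff.mp (X.coord_ne_zero P.1)
    have hqi := hq.rename_isHomogeneous (f := fun j => ((i, j) : X.σ × Y.σ))
    refine ⟨d, _, _, hp.rename_isHomogeneous (f := fun j => ((i, j) : X.σ × Y.σ)), hqi, _,
      (snd_continuous X Y U hU).inter (open_ne (X := X.prod Y) hqi), ⟨hx, ?_⟩, ?_⟩
    · change MvPolynomial.eval _ _ ≠ 0
      rw [eval_rename_snd X Y hq]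
      exact mul_ne_zero (pow_ne_zero _ hi) (h _ hx).1
    · rintro Q ⟨hQ, hQ'⟩
      refine ⟨hQ', ?_⟩
      change MvPolynomial.eval _ _ ≠ 0 at hQ'
      rw [eval_rename_snd X Y hq] at hQ'
      rw [eval_rename_snd X Y hq, eval_rename_snd X Y hp,
        mul_div_mul_left _ _ (left_ne_zero_of_mul hQ')]
      exact (h _ hQ).2

end ProjModel

/-- The dynamical Manin–Mumford question, as a statement: for every polarized dynamical system
`(X, f, L)` over an algebraically closed field of characteristic zero, and for every irreducible
subvariety `Y` of `X`, the irreducible components of the Zariski closure of the set of preperiodic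
points lying on `Y` are preperiodic subvarieties. -/
def DynamicalManinMumford : Prop :=
  ∀ (k : Type) [Field k] [IsAlgClosed k] [CharZero k] (X : ProjModel k) (f : ProjModel.Hom X X)
    (L : ProjModel.LineBundle X) (d : ℕ), ProjModel.IsPolarizedOfWeight f L d →
    ∀ Y : Set X.pts, X.Closed Y → X.Irred Y → ProjModel.ManinMumfordFor f Y

/-! ## The elliptic curve `y² = x³ - x` -/

namespace GhiocaTucker

/-- The elliptic curve `y² = x³ - x` over `ℂ`. -/
def E : WeierstrassCurve.Affine ℂ := ⟨0, 0, 0, -1, 0⟩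

theorem E_disc : E.Δ = 64 := by
  simp [E, WeierstrassCurve.Δ, WeierstrassCurve.b₂, WeierstrassCurve.b₄, WeierstrassCurve.b₆,
    WeierstrassCurve.b₈]
  norm_num

instance : E.IsElliptic := ⟨by rw [E_disc]; exact (by norm_num : (64 : ℂ) ≠ 0).isUnit⟩

theorem E_nonsingular_iff (x y : ℂ) : E.Nonsingular x y ↔ y ^ 2 = x ^ 3 - x := by
  rw [← E.equation_iff_nonsingular, E.equation_iff]
  simp [E, sub_eq_add_neg]

/-- Multiplication by `i` on the points of `E`: `(x, y) ↦ (-x, iy)`. -/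
def mulI : E.Point → E.Point
  | .zero => .zero
  | .some x y h => .some (-x) (I * y) (by
      rw [E_nonsingular_iff] at h ⊢
      rw [mul_pow, I_sq, h]
      ring)

/-- Multiplication `[a]` on the points of `E`, for a Gaussian integer `a = m + n i`:
`[a] P = m P + n ([i] P)` for the group law of `E`. -/
def mul (a : GaussianInt) (P : E.Point) : E.Point := a.re • P + a.im • mulI P

/-- Homogeneous coordinates of a point of `E`: the point at infinity is `[0 : 1 : 0]` and `(x, y)`
is `[x : y : 1]`. -/
def coordE : E.Point → Fin 3 → ℂ
  | .zero => ![0, 1, 0]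
  | .some x y _ => ![x, y, 1]

/-- The curve `E` in the projective plane. -/
abbrev curve : ProjModel ℂ where
  pts := E.Point
  σ := Fin 3
  coord := coordE
  coord_ne_zero P := by
    cases P with
    | zero => exact Function.ne_iff.mpr ⟨1, by simp [coordE]⟩
    | some x y h => exact Function.ne_iff.mpr ⟨2, by simp [coordE]⟩

/-- The trivializing open sets of `𝒪_E(0)`: the complement of the origin, and `{Y ≠ 0}`, which
contains the origin. -/
def originU : Bool → Set curve.pts
  | false => {P | coordE P 2 ≠ 0}
  | true => {P | coordE P 1 ≠ 0}

/-- Transition functions of `𝒪_E(0)`. On the complement of the origin the divisor `0` has the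
equation `1`, on `{Y ≠ 0}` it has the equation `X / Y`; the transition functions are the
quotients of these equations. -/
def originG : Bool → Bool → curve.pts → ℂ
  | true, false => fun P => coordE P 0 / coordE P 1
  | false, true => fun P => coordE P 1 / coordE P 0
  | _, _ => fun _ => 1

theorem coordE_zero_ne {P : E.Point} (h2 : coordE P 2 ≠ 0) (h1 : coordE P 1 ≠ 0) :
    coordE P 0 ≠ 0 := by
  cases P with
  | zero => simp [coordE] at h2
  | some x y h =>
    rw [E_nonsingular_iff] at h
    simp only [coordE, Matrix.cons_val_one, Matrix.cons_val_zero] at h1 ⊢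
    rintro rfl
    apply h1
    simpa using h

/-- The line bundle `𝒪_E(0)` of the divisor given by the origin of `E`. -/
def originBundle : ProjModel.LineBundle curve where
  ι := Bool
  U := originU
  isOpen
    | false => (ProjModel.LineBundle.hyperplane curve).isOpen (2 : Fin 3)
    | true => (ProjModel.LineBundle.hyperplane curve).isOpen (1 : Fin 3)
  cover P := by
    cases P with
    | zero => exact ⟨true, by simp [originU, coordE]⟩
    | some x y h => exact ⟨false, by simp [originU, coordE]⟩
  g := originG
  regular
    | true, true, P, _, _ => curve.regularAt_const 1 P
    | false, false, P, _, _ => curve.regularAt_const 1 P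
    | true, false, _, hi, _ => curve.regularAt_coord_div (1 : Fin 3) (0 : Fin 3) hi
    | false, true, _, hi, hj =>
      curve.regularAt_coord_div (0 : Fin 3) (1 : Fin 3) (coordE_zero_ne hi hj)
  self
    | true, _, _ => rfl
    | false, _, _ => rfl
  cocycle := by
    intro i j l P hi hj hl
    cases i <;> cases j <;> cases l <;> simp only [originG, one_mul, mul_one] <;>
      simp only [originU, Set.mem_ofPred_eq] at hi hj hl
    · have := coordE_zero_ne hi hj
      field_simp
    · have := coordE_zero_ne hj hi
      field_simp

/-- The surface `X = E × E`. -/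
abbrev surface : ProjModel ℂ := curve.prod curve

/-- The line bundle `𝒪_X(0 × E + E × 0)`, that is `pr₁^* 𝒪_E(0) ⊗ pr₂^* 𝒪_E(0)`. -/
def polarization : ProjModel.LineBundle surface :=
  (ProjModel.LineBundle.pullback (ProjModel.fst curve curve) originBundle).tensor
    (ProjModel.LineBundle.pullback (ProjModel.snd curve curve) originBundle)

/-- The map `([3 + 4i], [5])` from `E × E` to itself. -/
def selfMap (P : E.Point × E.Point) : E.Point × E.Point :=
  (mul ⟨3, 4⟩ P.1, mul 5 P.2)

/-- The diagonal of `E × E`. -/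
def diag : Set surface.pts := Set.diagonal E.Point

end GhiocaTucker

end

noncomputable section

namespace ProjModel

variable {k : Type} [Field k]

/-! ### Regular functions and locally polynomial maps -/

/-! The orbit of a torsion point of E under ℤ[i] is finite, so (P, P) is preperiodic whenever P is
torsion. There are infinitely many torsion points and nonempty Zariski open subsets of E are
cofinite, so these points are dense in the diagonal Δ (`zariskiClosure_preperiodic`). As Δ is
irreducible, it is the only component of that closure. Were Δ preperiodic, an equality f^m(Δ) =
f^(m+d)(Δ) with d ≥ 1 would give (3+4i)^d = 5^d, because a ↦ [a] is injective (`mulHom_injective`).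
But every positive power of 3+4i is congruent to 3+4i modulo 5 (`three_four_pow_ne`); the same fact
shows that (3+4i)/5 is not a root of unity.

The weight 25 comes from the factorizations 3+4i = (2+i)² and 5 = (2+i)(2-i): f is a composite of
two products of maps [2 ± i]. For J = ±i the addition law makes [2+J] explicit (`two_add_mulJ`):
with A = x² - 1 + 2J and B = (2+J)x² - J, the new abscissa is xA²/B². The zeros of B are the four
nonzero points of the kernel of [2+J], and B has a pole of order 4 at the origin; so div B =
[2+J]^*(0) - 5·(0), and multiplication by B is an isomorphism [2+J]^*𝒪(0) ≅ 𝒪(0)^5 (`pullbackIso`).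
External products and composition then give f^*ℒ ≅ ℒ^25.

For ampleness, the line at infinity meets E only at the origin, with multiplicity 3. Hence 𝒪(1) ≅
𝒪(0)^3 on E (`hyperplaneIso`), and 𝒪(1) of the Segre embedding of E × E is ℒ^3. -/

theorem RegularAt.congr {X : ProjModel k} {φ ψ : X.pts → k} {x : X.pts}
    (hφ : X.RegularAt φ x) {U : Set X.pts} (hU : X.Open U) (hx : x ∈ U)
    (h : ∀ y ∈ U, ψ y = φ y) : X.RegularAt ψ x := by
  obtain ⟨d, p, q, hp, hq, V, hV, hxV, hpq⟩ := hφ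
  exact ⟨d, p, q, hp, hq, U ∩ V, hU.inter hV, ⟨hx, hxV⟩, fun y hy =>
    ⟨(hpq y hy.2).1, (h y hy.1).trans (hpq y hy.2).2⟩⟩

theorem regularAt_div (X : ProjModel k) {d : ℕ} {p q : MvPolynomial X.σ k}
    (hp : p.IsHomogeneous d) (hq : q.IsHomogeneous d) {x : X.pts}
    (hx : MvPolynomial.eval (X.coord x) q ≠ 0) :
    X.RegularAt (fun y => MvPolynomial.eval (X.coord y) p / MvPolynomial.eval (X.coord y) q) x :=
  ⟨d, p, q, hp, hq, _, open_ne hq, hx, fun _ hy => ⟨hy, rfl⟩⟩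

theorem open_of_forall {X : ProjModel k} {V : Set X.pts}
    (h : ∀ x ∈ V, ∃ U, X.Open U ∧ x ∈ U ∧ U ⊆ V) : X.Open V := by
  let _ := X.zariski
  refine isOpen_iff_forall_mem_open.mpr fun x hx => ?_
  obtain ⟨U, hU, hxU, hUV⟩ := h x hx
  exact ⟨U, hUV, hU, hxU⟩

/-- A map given, locally on the source, by homogeneous polynomials of the same degree. -/
def IsLocallyPolynomial {X Y : ProjModel k} (f : X.pts → Y.pts) : Prop :=
  ∀ x, ∃ U, X.Open U ∧ x ∈ U ∧ ∃ (e : ℕ) (F : Y.σ → MvPolynomial X.σ k),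
    (∀ j, (F j).IsHomogeneous e) ∧ ∀ y ∈ U, ∃ c : k, c ≠ 0 ∧
      Y.coord (f y) = fun j => MvPolynomial.eval (X.coord y) (F j) * c

theorem eval_coord_eq {X Y : ProjModel k} {F : Y.σ → MvPolynomial X.σ k} {x : X.pts} {y : Y.pts}
    {c : k} (h : Y.coord y = fun j => MvPolynomial.eval (X.coord x) (F j) * c)
    {d : ℕ} {p : MvPolynomial Y.σ k} (hp : p.IsHomogeneous d) :
    MvPolynomial.eval (Y.coord y) p =
      c ^ d * MvPolynomial.eval (X.coord x) (MvPolynomial.aeval F p) := by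
  rw [h, eval_mul_right hp]
  exact congrArg _ (MvPolynomial.eval₂Hom_bind₁ (RingHom.id k) _ F p).symm

theorem IsLocallyPolynomial.open_preimage {X Y : ProjModel k} {f : X.pts → Y.pts}
    (hf : IsLocallyPolynomial f) (U : Set Y.pts) (hU : Y.Open U) : X.Open (f ⁻¹' U) := by
  refine continuous_of_basic f (fun d p hp => open_of_forall fun x hx => ?_) U hU
  obtain ⟨V, hV, hxV, e, F, hF, h⟩ := hf x
  have key : ∀ y ∈ V, (MvPolynomial.eval (Y.coord (f y)) p ≠ 0 ↔
      MvPolynomial.eval (X.coord y) (MvPolynomial.aeval F p) ≠ 0) := by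
    intro y hy
    obtain ⟨c, hc, hcoord⟩ := h y hy
    rw [eval_coord_eq hcoord hp, mul_ne_zero_iff, and_iff_right (pow_ne_zero _ hc)]
  exact ⟨_, hV.inter (open_ne (hp.aeval _ hF)), ⟨hxV, (key x hxV).1 hx⟩,
    fun y hy => (key y hy.1).2 hy.2⟩

/-- A locally polynomial map is a morphism. -/
def IsLocallyPolynomial.toHom {X Y : ProjModel k} {f : X.pts → Y.pts}
    (hf : IsLocallyPolynomial f) : Hom X Y where
  toFun := f
  continuous' := hf.open_preimage
  regular' := by
    rintro x φ ⟨d, p, q, hp, hq, U, hU, hx, hpq⟩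
    obtain ⟨V, hV, hxV, e, F, hF, h⟩ := hf x
    refine ⟨e * d, _, _, hp.aeval _ hF, hq.aeval _ hF, _, (hf.open_preimage U hU).inter hV,
      ⟨hx, hxV⟩, fun y hy => ?_⟩
    obtain ⟨c, hc, hcoord⟩ := h y hy.2
    obtain ⟨h1, h2⟩ := hpq _ hy.1
    rw [eval_coord_eq hcoord hq] at h1
    rw [eval_coord_eq hcoord hp, eval_coord_eq hcoord hq,
      mul_div_mul_left _ _ (pow_ne_zero _ hc)] at h2
    exact ⟨right_ne_zero_of_mul h1, h2⟩

theorem isLocallyPolynomial_of_forall {X Y : ProjModel k} {f : X.pts → Y.pts} {e : ℕ}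
    (F : Y.σ → MvPolynomial X.σ k) (hF : ∀ j, (F j).IsHomogeneous e)
    (h : ∀ y, ∃ c : k, c ≠ 0 ∧
      Y.coord (f y) = fun j => MvPolynomial.eval (X.coord y) (F j) * c) :
    IsLocallyPolynomial f :=
  fun _ => ⟨Set.univ, X.open_univ, trivial, e, F, hF, fun y _ => h y⟩

theorem IsLocallyPolynomial.prodMap {X Y X' Y' : ProjModel k} {f : X.pts → Y.pts}
    {g : X'.pts → Y'.pts} (hf : IsLocallyPolynomial f) (hg : IsLocallyPolynomial g) :
    IsLocallyPolynomial (X := X.prod X') (Y := Y.prod Y') (Prod.map f g) := by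
  rintro ⟨x, x'⟩
  obtain ⟨U, hU, hxU, e, F, hF, h⟩ := hf x
  obtain ⟨U', hU', hxU', e', F', hF', h'⟩ := hg x'
  obtain ⟨a, ha⟩ := Function.ne_iff.mp (X.coord_ne_zero x)
  obtain ⟨b, hb⟩ := Function.ne_iff.mp (X'.coord_ne_zero x')
  refine ⟨(Prod.fst ⁻¹' U ∩ Prod.snd ⁻¹' U') ∩
      {P | MvPolynomial.eval ((X.prod X').coord P) (MvPolynomial.X (a, b)) ≠ 0},
    ((fst_continuous X X' U hU).inter (snd_continuous X X' U' hU')).inter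
      (open_ne (X := X.prod X') (MvPolynomial.isHomogeneous_X k (a, b))),
    ⟨⟨hxU, hxU'⟩, ?_⟩, e + e', fun j =>
      MvPolynomial.rename (fun i => ((i, b) : X.σ × X'.σ)) (F j.1) *
      MvPolynomial.rename (fun i => ((a, i) : X.σ × X'.σ)) (F' j.2),
    fun j => (hF j.1).rename_isHomogeneous.mul (hF' j.2).rename_isHomogeneous, ?_⟩
  · simpa using ⟨ha, hb⟩
  · rintro ⟨y, y'⟩ ⟨⟨hy, hy'⟩, hab⟩
    obtain ⟨c, hc, hcoord⟩ := h y hy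
    obtain ⟨c', hc', hcoord'⟩ := h' y' hy'
    simp only [Set.mem_ofPred_eq, MvPolynomial.eval_X, mul_ne_zero_iff] at hab
    -- In Segre coordinates, `F` is read off column b and `F'` off row a, which introduces the
    -- factors `X'.coord y' b ^ e` and `X.coord y a ^ e'`. The constant removes them; they are
    -- nonzero where the Segre coordinate (a, b) is.
    refine ⟨c * c' / (X'.coord y' b ^ e * X.coord y a ^ e'), div_ne_zero (mul_ne_zero hc hc')
      (mul_ne_zero (pow_ne_zero _ hab.2) (pow_ne_zero _ hab.1)), ?_⟩
    funext j
    rw [map_mul, eval_rename_fst X X' (hF j.1), eval_rename_snd X X' (hF' j.2)]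
    have h1 := congrFun hcoord j.1
    have h2 := congrFun hcoord' j.2
    simp only [Prod.map] at h1 h2 ⊢
    rw [h1, h2]
    have := pow_ne_zero e hab.2
    have := pow_ne_zero e' hab.1
    field_simp

/-- The composition of two morphisms. -/
def Hom.comp {X Y Z : ProjModel k} (g : Hom Y Z) (f : Hom X Y) : Hom X Z where
  toFun := g.toFun ∘ f.toFun
  continuous' U hU := f.continuous' _ (g.continuous' U hU)
  regular' x φ hφ := f.regular' x _ (g.regular' _ φ hφ)

/-- The identity morphism. -/
def Hom.id (X : ProjModel k) : Hom X X where
  toFun x := x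
  continuous' _ hU := hU
  regular' _ _ h := h

/-- The identity isomorphism. -/
def Iso.refl (X : ProjModel k) : Iso X X := ⟨Hom.id X, Hom.id X, fun _ => rfl, fun _ => rfl⟩

/-! ### Slices, diagonals and irreducibility of products -/

theorem isLocallyPolynomial_prodMk_right (X Y : ProjModel k) (y : Y.pts) :
    IsLocallyPolynomial (X := X) (Y := X.prod Y) (fun x => (x, y)) :=
  isLocallyPolynomial_of_forall (e := 1)
    (fun j => MvPolynomial.C (Y.coord y j.2) * MvPolynomial.X j.1)
    (fun _ => MvPolynomial.isHomogeneous_C_mul_X _ _)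
    fun _ => ⟨1, one_ne_zero, by funext j; simp [mul_comm]⟩

theorem isLocallyPolynomial_prodMk_left (X Y : ProjModel k) (x : X.pts) :
    IsLocallyPolynomial (X := Y) (Y := X.prod Y) (fun y => (x, y)) :=
  isLocallyPolynomial_of_forall (e := 1)
    (fun j => MvPolynomial.C (X.coord x j.1) * MvPolynomial.X j.2)
    (fun _ => MvPolynomial.isHomogeneous_C_mul_X _ _)
    fun _ => ⟨1, one_ne_zero, by funext j; simp⟩

theorem isLocallyPolynomial_diag (X : ProjModel k) :
    IsLocallyPolynomial (X := X) (Y := X.prod X) (fun x => (x, x)) :=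
  isLocallyPolynomial_of_forall (e := 1 + 1)
    (fun j => MvPolynomial.X j.1 * MvPolynomial.X j.2)
    (fun _ => (MvPolynomial.isHomogeneous_X _ _).mul (MvPolynomial.isHomogeneous_X _ _))
    fun _ => ⟨1, one_ne_zero, by funext j; simp⟩

theorem irred_univ_iff {X : ProjModel k} [Nonempty X.pts] : X.Irred Set.univ ↔
    ∀ U V : Set X.pts, X.Open U → X.Open V → U.Nonempty → V.Nonempty → (U ∩ V).Nonempty := by
  let _ := X.zariski
  constructor
  · intro h U V hU hV hU' hV'
    simpa using h.2 U V hU hV (by simpa using hU') (by simpa using hV')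
  · intro h
    refine ⟨Set.univ_nonempty, fun U V hU hV hU' hV' => ?_⟩
    simpa using h U V hU hV (by simpa using hU') (by simpa using hV')

/-- The product of two irreducible varieties is irreducible. -/
theorem irred_prod {X Y : ProjModel k} (hX : X.Irred Set.univ) (hY : Y.Irred Set.univ) :
    (X.prod Y).Irred Set.univ := by
  obtain ⟨x₀, -⟩ := hX.1
  obtain ⟨y₀, -⟩ := hY.1
  have : Nonempty X.pts := ⟨x₀⟩
  have : Nonempty Y.pts := ⟨y₀⟩
  have : Nonempty (X.prod Y).pts := ⟨(x₀, y₀)⟩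
  rw [irred_univ_iff] at hX hY ⊢
  rintro U V hU hV ⟨⟨p, q⟩, hpq⟩ ⟨⟨p', q'⟩, hpq'⟩
  -- The horizontal slices of U at height q and of V at height q' meet over some x; then the
  -- vertical slices of U and V over this x are both nonempty, hence meet.
  obtain ⟨x, hx, hx'⟩ := hX _ _
    ((isLocallyPolynomial_prodMk_right X Y q).open_preimage U hU)
    ((isLocallyPolynomial_prodMk_right X Y q').open_preimage V hV) ⟨p, hpq⟩ ⟨p', hpq'⟩
  obtain ⟨y, hy, hy'⟩ := hY _ _
    ((isLocallyPolynomial_prodMk_left X Y x).open_preimage U hU)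
    ((isLocallyPolynomial_prodMk_left X Y x).open_preimage V hV) ⟨q, hx⟩ ⟨q', hx'⟩
  exact ⟨(x, y), hy, hy'⟩

/-! ### Isomorphisms of line bundles -/

namespace LineBundle

variable {X Y : ProjModel k}

/-- The composition of two isomorphisms of line bundles. -/
def Iso.trans {L M N : LineBundle X} (α : Iso L M) (β : Iso M N) : Iso L N where
  -- The intermediate chart of `M` is chosen point by point. The value does not depend on it, by
  -- `compat` and the cocycle relation, so near a point one fixed chart may be used to prove
  -- regularity.
  h a i x := β.h (M.cover x).choose i x * α.h a (M.cover x).choose x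
  regular a i x hx hx' := by
    set m := (M.cover x).choose
    have hm : x ∈ M.U m := (M.cover x).choose_spec
    refine ((β.regular m i x hm hx').mul (α.regular a m x hx hm)).congr
      (((M.isOpen m).inter (L.isOpen a)).inter (N.isOpen i)) ⟨⟨hm, hx⟩, hx'⟩ ?_
    rintro y ⟨⟨hy, hya⟩, hyi⟩
    have hn : y ∈ M.U (M.cover y).choose := (M.cover y).choose_spec
    set n := (M.cover y).choose
    rw [α.compat a a m n y hya hya hy hn, β.compat m n i i y hy hn hyi hyi, L.self a y hya,
      N.self i y hyi]
    linear_combination (β.h m i y * α.h a m y) * (M.cocycle m n m y hy hn hy) +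
      (β.h m i y * α.h a m y) * M.self m y hy
  ne_zero a i x hx hx' :=
    mul_ne_zero (β.ne_zero _ _ _ (M.cover x).choose_spec hx')
      (α.ne_zero _ _ _ hx (M.cover x).choose_spec)
  compat a b i j x ha hb hi hj := by
    have hm : x ∈ M.U (M.cover x).choose := (M.cover x).choose_spec
    rw [α.compat a b _ _ x ha hb hm hm, β.compat _ _ i j x hm hm hi hj, M.self _ x hm]
    ring

/-- Powers of isomorphic line bundles are isomorphic. -/
def Iso.pow {L M : LineBundle X} (α : Iso L M) (n : ℕ) : Iso (L.pow n) (M.pow n) where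
  h a i x := α.h a i x ^ n
  regular a i x hx hx' := (α.regular a i x hx hx').pow n
  ne_zero a i x hx hx' := pow_ne_zero n (α.ne_zero a i x hx hx')
  compat a b i j x ha hb hi hj := by
    rw [α.compat a b i j x ha hb hi hj, mul_pow, mul_pow]
    rfl

/-- The isomorphism between `(L ^ m) ^ n` and `L ^ (m * n)`. -/
def powMul (L : LineBundle X) (m n : ℕ) : Iso ((L.pow m).pow n) (L.pow (m * n)) where
  h a i x := L.g i a x ^ (m * n)
  regular a i x hx hx' := (L.regular i a x hx' hx).pow _
  ne_zero a i x hx hx' := pow_ne_zero _ fun h => by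
    have := L.cocycle i a i x hx' hx hx'
    rw [h, zero_mul, L.self i x hx'] at this
    exact zero_ne_one this
  compat a b i j x ha hb hi hj := by
    have h : L.g j b x = L.g j i x * L.g i a x * L.g a b x := by
      rw [L.cocycle j i a x hj hi ha, L.cocycle j a b x hj ha hb]
    simp only [LineBundle.pow]
    rw [h, mul_pow, mul_pow, pow_mul (L.g a b x)]

/-- Pullbacks of isomorphic line bundles are isomorphic. -/
def Iso.pullback {L M : LineBundle Y} (f : Hom X Y) (α : Iso L M) :
    Iso (LineBundle.pullback f L) (LineBundle.pullback f M) where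
  h a i x := α.h a i (f.toFun x)
  regular a i x hx hx' := f.regular' x _ (α.regular a i _ hx hx')
  ne_zero a i _ hx hx' := α.ne_zero a i _ hx hx'
  compat a b i j _ ha hb hi hj := α.compat a b i j _ ha hb hi hj

/-- The external tensor product of two line bundles. -/
abbrev box (L : LineBundle X) (M : LineBundle Y) : LineBundle (X.prod Y) :=
  (LineBundle.pullback (fst X Y) L).tensor (LineBundle.pullback (snd X Y) M)

/-- The external tensor product of isomorphisms `f^* L ≅ L' ^ n` and `g^* M ≅ M' ^ n`. -/
def Iso.boxPow {X' Y' : ProjModel k} {L : LineBundle X'} {M : LineBundle Y'} {L' : LineBundle X}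
    {M' : LineBundle Y} {n : ℕ} {f : Hom X X'} {g : Hom Y Y'}
    (α : Iso (LineBundle.pullback f L) (L'.pow n)) (β : Iso (LineBundle.pullback g M) (M'.pow n))
    (F : Hom (X.prod Y) (X'.prod Y')) (hF : F.toFun = Prod.map f.toFun g.toFun) :
    Iso (LineBundle.pullback F (box L M)) ((box L' M').pow n) where
  h a i P := α.h a.1 i.1 P.1 * β.h a.2 i.2 P.2
  regular a i P hP hP' := by
    replace hP : F.toFun P ∈ (box L M).U a := hP
    rw [hF] at hP
    exact ((fst X Y).regular' P _ (α.regular a.1 i.1 P.1 hP.1 hP'.1)).mul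
      ((snd X Y).regular' P _ (β.regular a.2 i.2 P.2 hP.2 hP'.2))
  ne_zero a i P hP hP' := by
    replace hP : F.toFun P ∈ (box L M).U a := hP
    rw [hF] at hP
    exact mul_ne_zero (α.ne_zero a.1 i.1 P.1 hP.1 hP'.1) (β.ne_zero a.2 i.2 P.2 hP.2 hP'.2)
  compat a b i j P ha hb hi hj := by
    replace ha : F.toFun P ∈ (box L M).U a := ha
    replace hb : F.toFun P ∈ (box L M).U b := hb
    rw [hF] at ha hb
    rw [α.compat a.1 b.1 i.1 j.1 P.1 ha.1 hb.1 hi.1 hj.1,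
      β.compat a.2 b.2 i.2 j.2 P.2 ha.2 hb.2 hi.2 hj.2]
    simp only [box, LineBundle.pow, LineBundle.tensor, LineBundle.pullback, fst, snd, hF, Prod.map]
    ring

/-- If `𝒪(1) ≅ L ^ n` on `X` and `𝒪(1) ≅ M ^ n` on `Y`, then `𝒪(1) ≅ (L ⊠ M) ^ n` on `X × Y`. -/
def Iso.hyperplaneBoxPow {L : LineBundle X} {M : LineBundle Y} {n : ℕ}
    (α : Iso (hyperplane X) (L.pow n)) (β : Iso (hyperplane Y) (M.pow n)) :
    Iso (hyperplane (X.prod Y)) ((box L M).pow n) where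
  h a i P := α.h a.1 i.1 P.1 * β.h a.2 i.2 P.2
  regular a i P hP hP' := by
    replace hP := mul_ne_zero_iff.1 hP
    exact ((fst X Y).regular' P _ (α.regular a.1 i.1 P.1 hP.1 hP'.1)).mul
      ((snd X Y).regular' P _ (β.regular a.2 i.2 P.2 hP.2 hP'.2))
  ne_zero a i P hP hP' := by
    replace hP := mul_ne_zero_iff.1 hP
    exact mul_ne_zero (α.ne_zero a.1 i.1 P.1 hP.1 hP'.1) (β.ne_zero a.2 i.2 P.2 hP.2 hP'.2)
  compat a b i j P ha hb hi hj := by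
    replace ha := mul_ne_zero_iff.1 ha
    replace hb := mul_ne_zero_iff.1 hb
    rw [α.compat a.1 b.1 i.1 j.1 P.1 ha.1 hb.1 hi.1 hj.1,
      β.compat a.2 b.2 i.2 j.2 P.2 ha.2 hb.2 hi.2 hj.2]
    simp only [box, LineBundle.pow, LineBundle.tensor, LineBundle.pullback, hyperplane, fst, snd,
      mul_div_mul_comm]
    ring

end LineBundle

end ProjModel

namespace GhiocaTucker

open WeierstrassCurve.Affine (Point)

/-! ### The group law and complex multiplication -/

theorem E_negY (x y : ℂ) : E.negY x y = -y := by
  simp [WeierstrassCurve.Affine.negY, E]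

theorem E_addX (x₁ x₂ l : ℂ) : E.addX x₁ x₂ l = l ^ 2 - x₁ - x₂ := by
  simp [WeierstrassCurve.Affine.addX, E]

theorem E_addY (x₁ x₂ y₁ l : ℂ) :
    E.addY x₁ x₂ y₁ l = -(l * (l ^ 2 - x₁ - x₂ - x₁) + y₁) := by
  rw [WeierstrassCurve.Affine.addY, WeierstrassCurve.Affine.negAddY, E_negY, E_addX]

theorem E_slope_of_ne {x₁ x₂ : ℂ} (y₁ y₂ : ℂ) (h : x₁ ≠ x₂) :
    E.slope x₁ x₂ y₁ y₂ = (y₁ - y₂) / (x₁ - x₂) :=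
  WeierstrassCurve.Affine.slope_of_X_ne h

theorem E_slope_self {x y₁ y₂ : ℂ} (h : y₁ ≠ -y₂) :
    E.slope x x y₁ y₂ = (3 * x ^ 2 - 1) / (2 * y₁) := by
  rw [WeierstrassCurve.Affine.slope_of_Y_ne rfl (by rwa [E_negY]), E_negY]
  simp only [E]
  congr 1 <;> ring

theorem some_congr {x y x' y' : ℂ} {h : E.Nonsingular x y} {h' : E.Nonsingular x' y'}
    (hx : x = x') (hy : y = y') : Point.some x y h = Point.some x' y' h' := by
  subst hx hy
  rfl

theorem add_some_eq {x₁ y₁ x₂ y₂ : ℂ} {h₁ : E.Nonsingular x₁ y₁} {h₂ : E.Nonsingular x₂ y₂}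
    (l : ℂ) (hx : x₁ ≠ x₂) (hl : l * (x₁ - x₂) = y₁ - y₂) :
    ∃ h, Point.some x₁ y₁ h₁ + Point.some x₂ y₂ h₂ =
      Point.some (l ^ 2 - x₁ - x₂) (-(l * (l ^ 2 - x₁ - x₂ - x₁) + y₁)) h := by
  have hs : E.slope x₁ x₂ y₁ y₂ = l := by
    rw [E_slope_of_ne _ _ hx, ← hl, mul_div_cancel_right₀ _ (sub_ne_zero.2 hx)]
  have h := WeierstrassCurve.Affine.nonsingular_add h₁ h₂ fun hxy => hx hxy.1
  rw [E_addX, E_addY, hs] at h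
  refine ⟨h, ?_⟩
  rw [Point.add_of_X_ne hx]
  exact some_congr (by rw [E_addX, hs]) (by rw [E_addY, hs])

theorem mulI_zero : mulI 0 = 0 := rfl

theorem mulI_mulI (P : E.Point) : mulI (mulI P) = -P := by
  cases P with
  | zero => rfl
  | some x y h =>
    rw [Point.neg_some]
    exact some_congr (neg_neg x) (by rw [E_negY, ← mul_assoc, I_mul_I, neg_one_mul])

theorem mulI_neg (P : E.Point) : mulI (-P) = -mulI P := by
  rw [← mulI_mulI, ← mulI_mulI (mulI P)]

/-- The substitution (x, y) ↦ (-x, iy) multiplies the slopes of chords and tangents by -i, hence is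
compatible with the addition formulas. -/
theorem mulI_add (P Q : E.Point) : mulI (P + Q) = mulI P + mulI Q := by
  cases P with
  | zero => change mulI (0 + Q) = 0 + mulI Q; rw [zero_add, zero_add]
  | some x₁ y₁ h₁ =>
    cases Q with
    | zero => change mulI (_ + 0) = mulI _ + 0; rw [add_zero, add_zero]
    | some x₂ y₂ h₂ =>
      by_cases hxy : x₁ = x₂ ∧ y₁ = E.negY x₂ y₂
      · have : Point.some x₂ y₂ h₂ = -Point.some x₁ y₁ h₁ := by
          rw [Point.neg_some]
          exact some_congr hxy.1.symm (by rw [hxy.2, E_negY, E_negY, neg_neg])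
        rw [this, mulI_neg, add_neg_cancel, add_neg_cancel, mulI_zero]
      · have hxy' : ¬ (-x₁ = -x₂ ∧ I * y₁ = E.negY (-x₂) (I * y₂)) := by
          rw [E_negY] at hxy ⊢
          rintro ⟨h1, h2⟩
          exact hxy ⟨neg_injective h1, mul_left_cancel₀ I_ne_zero (h2.trans (by ring))⟩
        have hs : E.slope (-x₁) (-x₂) (I * y₁) (I * y₂) = -I * E.slope x₁ x₂ y₁ y₂ := by
          rw [E_negY] at hxy hxy'
          by_cases hx : x₁ = x₂
          · subst hx
            rw [E_slope_self fun h => hxy ⟨rfl, h⟩, E_slope_self fun h => hxy' ⟨rfl, h⟩]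
            have hI : (-I) = 1 / I := by rw [one_div, inv_I]
            rw [hI, div_mul_div_comm]
            congr 1 <;> ring
          · rw [E_slope_of_ne _ _ hx, E_slope_of_ne _ _ fun h => hx (neg_injective h), ← mul_sub,
              ← neg_sub', div_neg, mul_div_assoc]
            ring
        rw [Point.add_some hxy]
        refine Eq.trans ?_ (Point.add_some hxy').symm
        refine some_congr ?_ ?_
        · rw [E_addX, E_addX, hs]
          linear_combination (-(E.slope x₁ x₂ y₁ y₂) ^ 2) * I_sq
        · rw [E_addY, E_addY, hs]
          linear_combination (-I * E.slope x₁ x₂ y₁ y₂ * (E.slope x₁ x₂ y₁ y₂ ^ 2)) * I_sq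

/-- The ring homomorphism from the Gaussian integers determined by a square root of `-1` in a ring
which need not be commutative. -/
def gaussianLift {R : Type*} [Ring R] (j : R) (hj : j * j = -1) : GaussianInt →+* R where
  toFun a := a.re • (1 : R) + a.im • j
  map_one' := by simp
  map_zero' := by simp
  map_add' a b := by
    simp only [Zsqrtd.re_add, Zsqrtd.im_add]
    module
  map_mul' a b := by
    simp only [Zsqrtd.re_mul, Zsqrtd.im_mul, mul_add, add_mul, smul_mul_smul, hj, one_mul, mul_one]
    module

/-- The endomorphism `[i]` of the group `E`. -/
def mulIEnd : AddMonoid.End E.Point := AddMonoidHom.mk' mulI mulI_add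

/-- The ring homomorphism `a ↦ [a]` from the Gaussian integers to the endomorphisms of `E`. -/
def mulHom : GaussianInt →+* AddMonoid.End E.Point :=
  gaussianLift mulIEnd (by ext P; exact mulI_mulI P)

theorem mulHom_apply (a : GaussianInt) (P : E.Point) : mulHom a P = mul a P := rfl

theorem mul_mul (a b : GaussianInt) (P : E.Point) : mul (a * b) P = mul a (mul b P) := by
  rw [← mulHom_apply, map_mul]
  rfl

theorem mul_zero_one (P : E.Point) : mul ⟨0, 1⟩ P = mulI P := by
  rw [mul, zero_zsmul, one_zsmul, zero_add]

theorem mul_intCast (n : ℤ) (P : E.Point) : mul n P = n • P := by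
  rw [mul, Zsqrtd.re_intCast, Zsqrtd.im_intCast, zero_zsmul, add_zero]

/-! ### Explicit formulas for [1 + J] and [2 + J] -/

/-- The addition `P + [J] P`, for a square root `J` of `-1`. -/
theorem add_mulJ {J x y : ℂ} (hJ : J ^ 2 = -1) (hx : x ≠ 0) (h : E.Nonsingular x y)
    (h' : E.Nonsingular (-x) (J * y)) :
    ∃ h'', Point.some x y h + Point.some (-x) (J * y) h' =
      Point.some (-J * (x ^ 2 - 1) / (2 * x))
        (-((1 - J) * y / (2 * x) * (-J * (x ^ 2 - 1) / (2 * x) - x) + y)) h'' := by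
  have hE := (E_nonsingular_iff x y).1 h
  have hne : x ≠ -x := fun h0 => hx (self_eq_neg.1 h0)
  have e : ((1 - J) * y / (2 * x)) ^ 2 - x - -x = -J * (x ^ 2 - 1) / (2 * x) := by
    field_simp
    linear_combination y ^ 2 * hJ - 2 * J * hE
  obtain ⟨h'', key⟩ := add_some_eq (h₁ := h) (h₂ := h') ((1 - J) * y / (2 * x)) hne (by
    field_simp; ring)
  refine ⟨?_, key.trans (some_congr e (by rw [e]))⟩
  rwa [e] at h''

/-- Here (u, v) = [1+J](x, y) and `l` is the slope of the chord through (x, y) and (u, v); its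
denominator comes from x - u = B/(2x). -/
theorem two_add_mulJ_algebra {J x y B u v l : ℂ} (hx : x ≠ 0) (hJ : J ^ 2 = -1)
    (hB : B = (2 + J) * x ^ 2 - J) (hu : u = -J * (x ^ 2 - 1) / (2 * x)) (hB0 : B ≠ 0)
    (hl : l = y * ((5 + J) * x ^ 2 + 1 + J) / (2 * x * B)) (hE : y ^ 2 = x ^ 3 - x)
    (hv : v = -((1 - J) * y / (2 * x) * (u - x) + y)) :
    l * (x - u) = y - v ∧ l ^ 2 - x - u = x * (x ^ 2 - 1 + 2 * J) ^ 2 / B ^ 2 ∧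
      -(l * (l ^ 2 - x - u - x) + y) * B ^ 3 =
        y * (x ^ 6 + (1 - 6 * J) * x ^ 4 + (15 + 12 * J) * x ^ 2 + (2 * J - 1)) := by
  have hX : l ^ 2 - x - u = x * (x ^ 2 - 1 + 2 * J) ^ 2 / B ^ 2 := by
    rw [hl, div_pow, mul_pow, hE, hu]
    clear hv hu hl hE
    field_simp
    grind
  refine ⟨?_, hX, ?_⟩
  · rw [hv, hl, hu]
    clear hX hu hv hl hE
    field_simp
    grind
  · rw [hX, hl]
    clear hX hu hv hl hE
    field_simp
    grind

/-- Explicit formula for `[2 ± i]`. -/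
theorem two_add_mulJ {J x y : ℂ} (hJ : J ^ 2 = -1) (h : E.Nonsingular x y)
    (h' : E.Nonsingular (-x) (J * y)) :
    ∃ c : ℂ, c ≠ 0 ∧
      coordE (Point.some x y h + (Point.some x y h + Point.some (-x) (J * y) h')) = fun j =>
        ![x * ((x ^ 2 - 1 + 2 * J) ^ 2 * ((2 + J) * x ^ 2 - J)),
          y * (x ^ 6 + (1 - 6 * J) * x ^ 4 + (15 + 12 * J) * x ^ 2 + (2 * J - 1)),
          ((2 + J) * x ^ 2 - J) ^ 3] j * c := by
  have hE := (E_nonsingular_iff x y).1 h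
  have hJ0 : J ≠ 0 := by rintro rfl; norm_num at hJ
  by_cases hx : x = 0
  · subst hx
    have hy : y = 0 := by simpa using hE
    subst hy
    -- The point (0, 0) is fixed by [J] and is 2-torsion, so [1+J] kills it and [2+J] fixes it.
    have hQ : Point.some (-0) (J * 0) h' = -Point.some 0 0 h := by
      rw [Point.neg_some]
      exact some_congr neg_zero (by rw [E_negY, mul_zero, neg_zero])
    rw [hQ, add_neg_cancel, add_zero]
    refine ⟨1 / (-J) ^ 3, by simp [hJ0], ?_⟩
    funext j
    fin_cases j <;> simp [coordE, hJ0]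
  obtain ⟨h'', hadd⟩ := add_mulJ hJ hx h h'
  rw [hadd]
  set B := (2 + J) * x ^ 2 - J with hB
  set u := -J * (x ^ 2 - 1) / (2 * x) with hu
  set v := -((1 - J) * y / (2 * x) * (u - x) + y) with hv
  have hux : u - x = -B / (2 * x) := by
    rw [hu, hB]; field_simp; ring
  -- If B = 0 then [1+J]P = -P, so [2+J]P is the origin, and the formula is correct provided that
  -- its middle entry is nonzero. Since B = 0 forces x² = (1+2J)/5, a vanishing of that entry would
  -- make J rational, against J² = -1.
  by_cases hB0 : B = 0
  · have hux' : x = u := by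
      rw [hB0, neg_zero, zero_div] at hux
      exact (sub_eq_zero.1 hux).symm
    have hvy : v = -y := by rw [hv, ← hux']; ring
    have hQ : Point.some u v h'' = -Point.some x y h := by
      rw [Point.neg_some]
      exact some_congr hux'.symm (by rw [E_negY, hvy])
    have hx2 : x ^ 2 = (1 + 2 * J) / 5 := by
      linear_combination (2 - J) / 5 * hB0 + (-(2 - J) / 5) * hB + (x ^ 2 - 1) / 5 * hJ
    have hC : x ^ 6 + (1 - 6 * J) * x ^ 4 + (15 + 12 * J) * x ^ 2 + (2 * J - 1) ≠ 0 := by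
      rw [show x ^ 6 = (x ^ 2) ^ 3 by ring, show x ^ 4 = (x ^ 2) ^ 2 by ring, hx2]
      intro h0
      have h1 : (-256 + 1408 * J) / 125 = 0 := by
        rw [← h0]
        grind
      have h2 : J = 2 / 11 := by linear_combination 125 / 1408 * h1
      rw [h2] at hJ
      norm_num at hJ
    have hy : y ≠ 0 := by
      rintro rfl
      have h1 : x * (x ^ 2 - 1) = 0 := by linear_combination -hE
      rcases mul_eq_zero.1 h1 with h1 | h1
      · exact hx h1
      · have : J = 2 := by linear_combination 5 / 2 * h1 - 5 / 2 * hx2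
        rw [this] at hJ
        norm_num at hJ
    rw [hQ, add_neg_cancel]
    refine ⟨_, inv_ne_zero (mul_ne_zero hy hC), ?_⟩
    funext j
    fin_cases j
    · simp [hB0, coordE]
    · simp [mul_inv_cancel₀ (mul_ne_zero hy hC), coordE, -mul_inv_rev]
    · simp [hB0, coordE]
  · have hne : x ≠ u := fun h0 => hB0 (by
      rw [← h0, sub_self, eq_div_iff (by simpa using hx)] at hux
      linear_combination hux)
    obtain ⟨h1, hX, hY⟩ := two_add_mulJ_algebra hx hJ hB hu hB0 rfl hE hv
    obtain ⟨h3, key⟩ := add_some_eq (h₁ := h) (h₂ := h'') _ hne h1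
    set l := y * ((5 + J) * x ^ 2 + 1 + J) / (2 * x * B) with hl
    refine ⟨1 / B ^ 3, by simp [hB0], ?_⟩
    rw [key]
    funext j
    fin_cases j
    · simp only [coordE, Fin.zero_eta, Matrix.cons_val_zero]
      rw [hX]
      field_simp
    · simp only [coordE, Fin.mk_one, Matrix.cons_val_one, Matrix.cons_val_zero]
      rw [← hY, one_div, mul_inv_cancel_right₀ (pow_ne_zero 3 hB0)]
    · simp [coordE, hB0]

/-! ### Torsion points -/

/-- By `add_mulJ`, [1+i]P has abscissa u exactly when x² - 2iux - 1 = 0, which is solved by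
completing the square. A point is determined by its abscissa up to sign, so P or -P maps to Q. -/
theorem mul_one_one_surjective (Q : E.Point) : ∃ P, mul ⟨1, 1⟩ P = Q := by
  have hmul : ∀ P : E.Point, mul ⟨1, 1⟩ P = P + mulI P := fun P => by
    rw [mul, one_zsmul, one_zsmul]
  cases Q with
  | zero => exact ⟨0, (mulHom ⟨1, 1⟩).map_zero⟩
  | some u v h =>
    obtain ⟨s, hs⟩ := IsAlgClosed.exists_pow_nat_eq (1 - u ^ 2) (n := 2) two_pos
    set x := I * u + s with hx
    have hx2 : x ^ 2 = 1 + 2 * I * u * x := by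
      rw [hx]
      linear_combination hs - u ^ 2 * I_sq
    have hx0 : x ≠ 0 := by
      intro h0
      rw [h0] at hx2
      norm_num at hx2
    obtain ⟨y, hy⟩ := IsAlgClosed.exists_pow_nat_eq (x ^ 3 - x) (n := 2) two_pos
    have hP : E.Nonsingular x y := (E_nonsingular_iff x y).2 hy
    have hiP : E.Nonsingular (-x) (I * y) := (E_nonsingular_iff _ _).2 (by
      linear_combination (y ^ 2) * I_sq - hy)
    obtain ⟨h', key⟩ := add_mulJ I_sq hx0 hP hiP
    have hu : -I * (x ^ 2 - 1) / (2 * x) = u := by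
      rw [hx2]
      field_simp
      linear_combination (-2 * u * x) * I_sq
    have hmP : mul ⟨1, 1⟩ (Point.some x y hP) = _ := (hmul _).trans key
    rcases Point.X_eq_iff (h₁ := h') (h₂ := h) |>.1 hu with h1 | h1
    · exact ⟨_, hmP.trans h1⟩
    · refine ⟨-Point.some x y hP, ?_⟩
      rw [← mulHom_apply, map_neg, mulHom_apply, hmP, h1, neg_neg]

/-- Since (1+i)² = 2i, if Q = [1+i]²R then Q = 2[i]R. -/
theorem two_zsmul_surjective (Q : E.Point) : ∃ P, 2 • P = Q := by
  obtain ⟨P, hP⟩ := mul_one_one_surjective Q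
  obtain ⟨R, hR⟩ := mul_one_one_surjective P
  refine ⟨mul ⟨0, 1⟩ R, ?_⟩
  rw [← hP, ← hR, ← mul_mul, ← natCast_zsmul, ← mul_intCast, ← mul_mul]
  rfl

/-- Halve the 2-torsion point (0, 0) n times. -/
theorem exists_addOrderOf_eq (n : ℕ) : ∃ P : E.Point, addOrderOf P = 2 ^ (n + 1) := by
  choose s hs using two_zsmul_surjective
  have hT : E.Nonsingular 0 0 := (E_nonsingular_iff 0 0).2 (by norm_num)
  set T := Point.some 0 0 hT
  have hT0 : T ≠ 0 := Point.some_ne_zero hT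
  have hT2 : 2 • T = 0 := by
    rw [two_nsmul]
    exact Point.add_self_of_Y_eq (by rw [E_negY, neg_zero])
  have hiter : ∀ n : ℕ, 2 ^ n • s^[n] T = T := by
    intro n
    induction n with
    | zero => simp
    | succ n ih => rw [Function.iterate_succ_apply', pow_succ, mul_nsmul', hs, ih]
  have hp : Fact (Nat.Prime 2) := ⟨Nat.prime_two⟩
  refine ⟨s^[n] T, addOrderOf_eq_prime_pow (by rwa [hiter]) ?_⟩
  rw [pow_succ, mul_nsmul, hiter, hT2]

theorem infinite_torsion : {P : E.Point | ∃ N : ℕ, 0 < N ∧ N • P = 0}.Infinite := by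
  choose P hP using exists_addOrderOf_eq
  refine Set.infinite_of_injective_forall_mem (f := P) (fun m n h => ?_) fun n =>
    ⟨2 ^ (n + 1), by positivity, by rw [← hP n]; exact addOrderOf_nsmul_eq_zero _⟩
  have := hP m
  rw [h, hP n] at this
  have := Nat.pow_right_injective le_rfl this
  omega

/-- If [a] = 0 with a ≠ 0, then the positive integer N(a) = ā·a kills every point; this contradicts
the existence of a point of order 2^(N(a)+1) > N(a). -/
theorem mulHom_injective : Function.Injective mulHom := by
  rw [injective_iff_map_eq_zero]
  intro a ha
  by_contra h0
  have hn : (a.norm.natAbs : GaussianInt) = star a * a := by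
    rw [GaussianInt.natCast_natAbs_norm, Zsqrtd.norm_eq_mul_conj, mul_comm]
  have hkill : ∀ P : E.Point, a.norm.natAbs • P = 0 := fun P => by
    rw [← natCast_zsmul, ← mul_intCast, Int.cast_natCast, hn, ← mulHom_apply, map_mul, ha]
    exact (mulHom (star a)).map_zero
  have hpos : 0 < a.norm.natAbs := Int.natAbs_pos.2 (GaussianInt.norm_pos.2 h0).ne'
  obtain ⟨P, hP⟩ := exists_addOrderOf_eq a.norm.natAbs
  have h1 := Nat.le_of_dvd hpos (addOrderOf_dvd_of_nsmul_eq_zero (hkill P))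
  rw [hP] at h1
  exact absurd (h1.trans_lt (Nat.lt_succ_self _)) (Nat.lt_two_pow_self.not_gt)

/-! ### Dynamics of the group endomorphisms -/

/-- Since (3+4i)² = -7+24i ≡ 3+4i modulo 5, the imaginary part of every positive power is congruent
to 4 modulo 5, hence is nonzero. -/
theorem three_four_pow_ne {n : ℕ} (hn : 1 ≤ n) : ((⟨3, 4⟩ : GaussianInt) ^ n) ≠ 5 ^ n := by
  have key : ∀ n : ℕ, ∃ a b : ℤ, (⟨3, 4⟩ : GaussianInt) ^ (n + 1) = ⟨5 * a + 3, 5 * b + 4⟩ := by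
    intro n
    induction n with
    | zero => exact ⟨0, 0, by simp⟩
    | succ n ih =>
      obtain ⟨a, b, h⟩ := ih
      refine ⟨3 * a - 4 * b - 2, 4 * a + 3 * b + 4, ?_⟩
      rw [pow_succ, h]
      ext <;> simp only [Zsqrtd.re_mul, Zsqrtd.im_mul] <;> ring
  obtain ⟨m, rfl⟩ := Nat.exists_eq_add_of_le' hn
  obtain ⟨a, b, h⟩ := key m
  rw [h, show (5 : GaussianInt) ^ (m + 1) = ((5 ^ (m + 1) : ℤ) : GaussianInt) by push_cast; rfl]
  intro h0
  have : 5 * b + 4 = 0 := (congrArg Zsqrtd.im h0).trans (Zsqrtd.im_intCast _)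
  omega

theorem three_add_four_I_div_pow_ne_one {n : ℕ} (hn : 1 ≤ n) :
    ((3 + 4 * I) / 5 : ℂ) ^ n ≠ 1 := by
  rw [div_pow, Ne, div_eq_one_iff_eq (pow_ne_zero n (by norm_num))]
  intro h
  refine three_four_pow_ne hn (GaussianInt.toComplex_injective ?_)
  rw [map_pow, map_pow, GaussianInt.toComplex_def', map_ofNat]
  exact_mod_cast h

theorem selfMap_iterate (n : ℕ) (P Q : E.Point) :
    selfMap^[n] (P, Q) = (mul (⟨3, 4⟩ ^ n) P, mul (5 ^ n) Q) := by
  induction n with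
  | zero =>
    have h1 : ∀ R : E.Point, mul 1 R = R := fun R => by
      rw [← mulHom_apply, map_one]; rfl
    rw [pow_zero, pow_zero, h1, h1]
    rfl
  | succ n ih =>
    rw [Function.iterate_succ_apply', ih, pow_succ', pow_succ', mul_mul, mul_mul]
    rfl

/-- The diagonal is not a preperiodic subvariety. -/
theorem not_isPreperiodicSubvariety_diag :
    ¬ ProjModel.IsPreperiodicSubvariety selfMap (diag : Set (E.Point × E.Point)) := by
  intro h
  obtain ⟨m, n, hmn, heq⟩ : ∃ m n : ℕ, m < n ∧ selfMap^[m] '' diag = selfMap^[n] '' diag := by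
    by_contra! hne
    refine Set.infinite_range_of_injective (fun m n hmn => ?_) h
    rcases lt_trichotomy m n with hlt | heq | hlt
    · exact (hne m n hlt hmn).elim
    · exact heq
    · exact (hne n m hlt hmn.symm).elim
  obtain ⟨d, hd, rfl⟩ : ∃ d, 1 ≤ d ∧ n = m + d := ⟨n - m, by omega, by omega⟩
  set α : GaussianInt := ⟨3, 4⟩ with hα
  -- The image of (P, P) under the iterate m + d equals that of some (Q, Q) under the iterate m:
  -- α^(m+d)P = α^m Q and 5^(m+d)P = 5^m Q. Multiplying by 5^m and α^m respectively eliminates Q.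
  have key : ∀ P : E.Point, mul (5 ^ m * α ^ (m + d)) P = mul (α ^ m * 5 ^ (m + d)) P := by
    intro P
    have hP : selfMap^[m + d] (P, P) ∈ selfMap^[m] '' (diag : Set (E.Point × E.Point)) := by
      rw [heq]
      exact ⟨(P, P), rfl, rfl⟩
    obtain ⟨⟨Q, Q'⟩, hQ, hQP⟩ := hP
    obtain rfl : Q = Q' := hQ
    rw [selfMap_iterate, selfMap_iterate, Prod.mk.injEq] at hQP
    rw [mul_mul, mul_mul, ← hQP.1, ← hQP.2, ← mul_mul, ← mul_mul, mul_comm]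
  have h1 : 5 ^ m * α ^ (m + d) = α ^ m * 5 ^ (m + d) :=
    mulHom_injective (by ext P; exact key P)
  have h5 : (5 : GaussianInt) ≠ 0 := by decide
  have hα0 : α ≠ 0 := by rw [hα]; decide
  refine three_four_pow_ne hd (mul_left_cancel₀ (mul_ne_zero (pow_ne_zero m h5)
    (pow_ne_zero m hα0)) ?_)
  linear_combination h1

/-- Both P and [i]P are killed by N, so [a]P depends only on the real and imaginary parts of a
modulo N. -/
theorem finite_orbit_of_torsion {N : ℕ} (hN : 0 < N) {P : E.Point} (hP : N • P = 0) :
    (Set.range fun a : GaussianInt => mul a P).Finite := by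
  have hred : ∀ (n : ℤ) (Q : E.Point), N • Q = 0 → (n % N) • Q = n • Q := by
    intro n Q hQ
    conv_rhs => rw [← Int.emod_add_mul_ediv n N, add_zsmul, mul_comm, mul_zsmul, natCast_zsmul,
      hQ, zsmul_zero, add_zero]
  have hIP : N • mulI P = 0 := by
    change N • mulIEnd P = 0
    rw [← map_nsmul, hP, map_zero]
  refine ((Set.finite_Ico (0 : ℤ) N).prod (Set.finite_Ico (0 : ℤ) N)
    |>.image fun p => p.1 • P + p.2 • mulI P).subset ?_
  rintro _ ⟨a, rfl⟩
  have hN' : (0 : ℤ) < N := by exact_mod_cast hN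
  refine ⟨(a.re % N, a.im % N), ⟨⟨Int.emod_nonneg _ hN'.ne', Int.emod_lt_of_pos _ hN'⟩,
    ⟨Int.emod_nonneg _ hN'.ne', Int.emod_lt_of_pos _ hN'⟩⟩, ?_⟩
  simp only [mul, hred _ _ hP, hred _ _ hIP]

theorem mem_preperiodicPoints_of_finite_orbit {S : Type} {f : S → S} {x : S} {T : Set S}
    (hT : T.Finite) (h : ∀ n : ℕ, f^[n] x ∈ T) : x ∈ ProjModel.preperiodicPoints f := by
  obtain ⟨m, n, hmn, heq⟩ := hT.exists_lt_map_eq_of_forall_mem h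
  refine ⟨m, Function.mk_mem_periodicPts (n := n - m) (by omega) ?_⟩
  rw [Function.IsPeriodicPt, Function.IsFixedPt, ← Function.iterate_add_apply, heq]
  congr 2
  omega

theorem preperiodic_of_torsion {N : ℕ} (hN : 0 < N) {P : E.Point} (hP : N • P = 0) :
    (P, P) ∈ ProjModel.preperiodicPoints selfMap := by
  refine mem_preperiodicPoints_of_finite_orbit
    ((finite_orbit_of_torsion hN hP).prod (finite_orbit_of_torsion hN hP)) fun n => ?_
  rw [selfMap_iterate]
  exact ⟨⟨_, rfl⟩, ⟨_, rfl⟩⟩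

/-! ### The Zariski topology of the curve -/

/-- The affine coordinate ring of E is spanned by 1 and y over ℂ[x]. -/
theorem exists_eval_eq_add_mul (p : MvPolynomial (Fin 3) ℂ) :
    ∃ a b : Polynomial ℂ, ∀ x y : ℂ, y ^ 2 = x ^ 3 - x →
      MvPolynomial.eval ![x, y, 1] p = a.eval x + b.eval x * y := by
  induction p using MvPolynomial.induction_on with
  | C c => exact ⟨Polynomial.C c, 0, fun x y _ => by simp⟩
  | add p q hp hq =>
    obtain ⟨a, b, h⟩ := hp
    obtain ⟨a', b', h'⟩ := hq
    refine ⟨a + a', b + b', fun x y hxy => ?_⟩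
    rw [map_add, h x y hxy, h' x y hxy, Polynomial.eval_add, Polynomial.eval_add]
    ring
  | mul_X p i hp =>
    obtain ⟨a, b, h⟩ := hp
    fin_cases i
    · refine ⟨a * Polynomial.X, b * Polynomial.X, fun x y hxy => ?_⟩
      rw [map_mul, h x y hxy]
      simp
      ring
    · refine ⟨b * (Polynomial.X ^ 3 - Polynomial.X), a, fun x y hxy => ?_⟩
      rw [map_mul, h x y hxy]
      simp
      linear_combination (b.eval x) * hxy
    · refine ⟨a, b, fun x y hxy => ?_⟩
      rw [map_mul, h x y hxy]
      simp

/-- This is the norm of a + by down to ℂ[x]. Cancellation is impossible: a² has even degree, while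
b²(x³ - x) has odd degree if b ≠ 0. -/
theorem sq_sub_sq_mul_ne_zero {a b : Polynomial ℂ} (h : ¬ (a = 0 ∧ b = 0)) :
    a ^ 2 - b ^ 2 * (Polynomial.X ^ 3 - Polynomial.X) ≠ 0 := by
  intro h0
  rw [sub_eq_zero] at h0
  have hdeg : (Polynomial.X ^ 3 - Polynomial.X : Polynomial ℂ).natDegree = 3 := by
    compute_degree!
  by_cases hb : b = 0
  · rw [hb] at h0
    exact h ⟨by simpa using h0, hb⟩
  · have := congrArg Polynomial.natDegree h0
    rw [Polynomial.natDegree_pow, Polynomial.natDegree_mul (pow_ne_zero 2 hb)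
      (fun h => by simp [h] at hdeg), Polynomial.natDegree_pow, hdeg] at this
    omega

theorem finite_fiber (x : ℂ) : {P : E.Point | ∃ y h, P = Point.some x y h}.Finite := by
  by_cases hne : ∃ y, E.Nonsingular x y
  · obtain ⟨y₀, h₀⟩ := hne
    refine Set.Finite.subset (s := {Point.some x y₀ h₀, -Point.some x y₀ h₀}) (by simp) ?_
    rintro _ ⟨y, h, rfl⟩
    exact Point.X_eq_iff.1 rfl
  · exact Set.finite_empty.subset fun P ⟨y, h, _⟩ => hne ⟨y, h⟩

/-- A form that vanishes at all affine points of `E` vanishes at infinity. -/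
theorem eval_infinity_eq_zero {d : ℕ} {p : MvPolynomial (Fin 3) ℂ} (hp : p.IsHomogeneous d)
    (h : ∀ x y : ℂ, y ^ 2 = x ^ 3 - x → MvPolynomial.eval ![x, y, 1] p = 0) :
    MvPolynomial.eval ![0, 1, 0] p = 0 := by
  -- A real path on E with affine coordinates x = t⁻², y = √(1 - t⁴)/t³, rescaled by t³ so that it
  -- extends to the origin [0 : 1 : 0] at t = 0. Vanishing for 0 < t < 1 then passes to the limit in
  -- the usual topology.
  let v : ℝ → Fin 3 → ℂ := fun t => ![(t : ℂ), (Real.sqrt (1 - t ^ 4) : ℂ), (t : ℂ) ^ 3]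
  have hv : Continuous v := by
    refine continuous_pi fun i => ?_
    fin_cases i <;> simp only [v] <;> dsimp <;> fun_prop
  have hcont : Continuous fun t => MvPolynomial.eval (v t) p :=
    (MvPolynomial.continuous_eval p).comp hv
  have hzero : ∀ t ∈ Set.Ioo (0 : ℝ) 1, MvPolynomial.eval (v t) p = 0 := by
    rintro t ⟨ht0, ht1⟩
    have htC : (t : ℂ) ≠ 0 := by exact_mod_cast ht0.ne'
    have hs : (Real.sqrt (1 - t ^ 4) : ℂ) ^ 2 = 1 - (t : ℂ) ^ 4 := by
      rw [← ofReal_pow, Real.sq_sqrt (by linarith [pow_lt_one₀ ht0.le ht1 (n := 4) (by norm_num)])]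
      push_cast
      rfl
    have hxy := h (1 / (t : ℂ) ^ 2) ((Real.sqrt (1 - t ^ 4) : ℂ) / (t : ℂ) ^ 3) (by
      rw [div_pow, hs]
      field_simp)
    have hvt : v t = fun i => ![1 / (t : ℂ) ^ 2, (Real.sqrt (1 - t ^ 4) : ℂ) / (t : ℂ) ^ 3, 1] i *
        (t : ℂ) ^ 3 := by
      funext i
      fin_cases i
      · simp [v]; field_simp
      · simp [v, htC]
      · simp [v]
    rw [hvt, ProjModel.eval_mul_right hp, hxy, mul_zero]
  have hv0 : v 0 = ![0, 1, 0] := by simp [v]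
  rw [← hv0]
  have hclosed : IsClosed {t | MvPolynomial.eval (v t) p = 0} :=
    isClosed_eq hcont continuous_const
  have hsub := hclosed.closure_subset_iff.2 hzero
  rw [closure_Ioo (by norm_num)] at hsub
  exact hsub ⟨le_rfl, zero_le_one⟩

/-- The abscissa of an affine zero is a root of the norm, a nonzero polynomial in x, and each
abscissa carries at most two points. -/
theorem eval_coordE_finite {d : ℕ} {p : MvPolynomial (Fin 3) ℂ} (hp : p.IsHomogeneous d)
    {P : E.Point} (hP : MvPolynomial.eval (coordE P) p ≠ 0) :
    {Q : E.Point | MvPolynomial.eval (coordE Q) p = 0}.Finite := by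
  obtain ⟨a, b, hab⟩ := exists_eval_eq_add_mul p
  have hne : ¬ (a = 0 ∧ b = 0) := by
    rintro ⟨rfl, rfl⟩
    have haff : ∀ x y : ℂ, y ^ 2 = x ^ 3 - x → MvPolynomial.eval ![x, y, 1] p = 0 := by
      intro x y hxy
      simpa using hab x y hxy
    cases P with
    | zero => exact hP (eval_infinity_eq_zero hp haff)
    | some x y h => exact hP (haff x y ((E_nonsingular_iff x y).1 h))
  refine ((Set.finite_singleton (0 : E.Point)).union
    ((Polynomial.finite_setOfPred_isRoot (sq_sub_sq_mul_ne_zero hne)).biUnion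
      fun x _ => finite_fiber x)).subset fun Q hQ => ?_
  cases Q with
  | zero => exact Or.inl rfl
  | some x y h =>
    refine Or.inr (Set.mem_biUnion (x := x) ?_ ⟨y, h, rfl⟩)
    have hxy := (E_nonsingular_iff x y).1 h
    have h0 : a.eval x + b.eval x * y = 0 := (hab x y hxy).symm.trans hQ
    simp only [Set.mem_ofPred_eq, Polynomial.IsRoot.def, Polynomial.eval_sub, Polynomial.eval_mul,
      Polynomial.eval_pow, Polynomial.eval_X]
    linear_combination (a.eval x - b.eval x * y) * h0 + (b.eval x) ^ 2 * hxy

theorem compl_finite_of_open {U : Set E.Point} (hU : curve.Open U) (hne : U.Nonempty) :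
    Uᶜ.Finite := by
  have h : TopologicalSpace.GenerateOpen {U | ∃ (d : ℕ) (p : MvPolynomial curve.σ ℂ),
      p.IsHomogeneous d ∧ U = {x | MvPolynomial.eval (curve.coord x) p ≠ 0}} U := hU
  clear hU
  induction h with
  | basic s hs =>
    obtain ⟨d, p, hp, rfl⟩ := hs
    obtain ⟨P, hP⟩ := hne
    refine (eval_coordE_finite hp hP).subset fun Q hQ => ?_
    simpa using hQ
  | univ => simp
  | inter s t _ _ hs ht =>
    rw [Set.compl_inter]
    exact (hs (hne.mono Set.inter_subset_left)).union (ht (hne.mono Set.inter_subset_right))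
  | sUnion S _ hS =>
    obtain ⟨P, s, hs, hP⟩ := hne
    exact (hS s hs ⟨P, hP⟩).subset (Set.compl_subset_compl.2 (Set.subset_sUnion_of_mem hs))

instance : Infinite E.Point :=
  Set.infinite_univ_iff.1 (infinite_torsion.mono (Set.subset_univ _))

theorem curve_irred : curve.Irred Set.univ := by
  have : Nonempty curve.pts := ⟨(0 : E.Point)⟩
  rw [ProjModel.irred_univ_iff]
  intro U V hU hV hU' hV'
  by_contra h
  have hfin := (compl_finite_of_open hU hU').union (compl_finite_of_open hV hV')
  rw [← Set.compl_inter, Set.not_nonempty_iff_eq_empty.1 h, Set.compl_empty] at hfin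
  exact Set.infinite_univ (α := E.Point) hfin

/-! ### The surface is a projective variety -/

theorem coordE_injective {P Q : E.Point}
    (h : ∀ i j, coordE P i * coordE Q j = coordE P j * coordE Q i) : P = Q := by
  cases P with
  | zero =>
    cases Q with
    | zero => rfl
    | some x y hxy => simpa [coordE] using h 1 2
  | some x y hxy =>
    cases Q with
    | zero => simpa [coordE] using h 1 2
    | some x' y' hxy' =>
      exact some_congr (by simpa [coordE] using h 0 2) (by simpa [coordE] using h 1 2)

theorem coordE_equation (P : E.Point) :
    coordE P 1 ^ 2 * coordE P 2 = coordE P 0 ^ 3 - coordE P 0 * coordE P 2 ^ 2 := by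
  cases P with
  | zero => simp [coordE]
  | some x y h =>
    rw [E_nonsingular_iff] at h
    simpa [coordE] using h

/-- The zero vector is allowed, with c = 0. On the line Z = 0 the equation forces X = 0, which
leaves only the origin. -/
theorem exists_coordE_eq {w : Fin 3 → ℂ}
    (h : w 1 ^ 2 * w 2 = w 0 ^ 3 - w 0 * w 2 ^ 2) :
    ∃ (P : E.Point) (c : ℂ), w = fun i => c * coordE P i := by
  by_cases h2 : w 2 = 0
  · have h0 : w 0 = 0 := by
      rw [h2] at h
      exact pow_eq_zero_iff (n := 3) (by norm_num) |>.1 (by linear_combination -h)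
    refine ⟨Point.zero, w 1, ?_⟩
    funext i
    fin_cases i <;> simp [coordE, h0, h2]
  · have hxy : E.Nonsingular (w 0 / w 2) (w 1 / w 2) := by
      rw [E_nonsingular_iff]
      field_simp
      linear_combination h
    refine ⟨Point.some _ _ hxy, w 2, ?_⟩
    funext i
    fin_cases i
    · simp [coordE]; field_simp
    · simp [coordE]; field_simp
    · simp [coordE]

/-- The equation of `E`, in the variables `X_{f 0}, X_{f 1}, X_{f 2}`. -/
def cubic {σ : Type} (f : Fin 3 → σ) : MvPolynomial σ ℂ :=
  MvPolynomial.X (f 1) ^ 2 * MvPolynomial.X (f 2) -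
    (MvPolynomial.X (f 0) ^ 3 - MvPolynomial.X (f 0) * MvPolynomial.X (f 2) ^ 2)

theorem cubic_isHomogeneous {σ : Type} (f : Fin 3 → σ) : (cubic f).IsHomogeneous 3 :=
  (((MvPolynomial.isHomogeneous_X_pow _ 2).mul (MvPolynomial.isHomogeneous_X _ _)).sub
    ((MvPolynomial.isHomogeneous_X_pow _ 3).sub
      ((MvPolynomial.isHomogeneous_X _ _).mul (MvPolynomial.isHomogeneous_X_pow _ 2))))

theorem eval_cubic {σ : Type} (f : Fin 3 → σ) (z : σ → ℂ) : MvPolynomial.eval z (cubic f) =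
    z (f 1) ^ 2 * z (f 2) - (z (f 0) ^ 3 - z (f 0) * z (f 2) ^ 2) := by
  simp [cubic]

theorem surface_point_injective : Function.Injective surface.point := by
  rintro ⟨P, Q⟩ ⟨P', Q'⟩ h
  obtain ⟨c, hc⟩ := (Projectivization.mk_eq_mk_iff' ℂ _ _ _ _).1 h
  have key : ∀ i j, c * (coordE P' i * coordE Q' j) = coordE P i * coordE Q j :=
    fun i j => congrFun hc (i, j)
  refine Prod.ext ?_ ?_
  · obtain ⟨l, hl⟩ := Function.ne_iff.mp (curve.coord_ne_zero Q)
    refine coordE_injective fun i j => mul_right_cancel₀ hl ?_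
    change coordE P i * coordE P' j * coordE Q l = coordE P j * coordE P' i * coordE Q l
    linear_combination coordE P' i * key j l - coordE P' j * key i l
  · obtain ⟨l, hl⟩ := Function.ne_iff.mp (curve.coord_ne_zero P)
    refine coordE_injective fun i j => mul_right_cancel₀ hl ?_
    change coordE Q i * coordE Q' j * coordE P l = coordE Q j * coordE Q' i * coordE P l
    linear_combination coordE Q' i * key l j - coordE Q' j * key l i

/-- Homogeneous equations of `E × E` in the Segre embedding. -/
def surfaceEquations : Set (MvPolynomial (Fin 3 × Fin 3) ℂ) :=
  {p | (∃ i j k l, p = MvPolynomial.X (i, j) * MvPolynomial.X (k, l) -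
    MvPolynomial.X (i, l) * MvPolynomial.X (k, j)) ∨
    (∃ j, p = cubic fun i => (i, j)) ∨ ∃ i, p = cubic fun j => (i, j)}

theorem range_surface_point : Set.range surface.point = ProjModel.zeroLocus surfaceEquations := by
  ext v
  constructor
  · rintro ⟨⟨P, Q⟩, rfl⟩ p hp
    obtain ⟨c, hc⟩ := Projectivization.exists_smul_eq_mk_rep ℂ _ (surface.coord_ne_zero (P, Q))
    have key : ∀ i j, (surface.point (P, Q)).rep (i, j) = c * (coordE P i * coordE Q j) :=
      fun i j => (congrFun hc (i, j)).symm
    rcases hp with ⟨i, j, k, l, rfl⟩ | ⟨j, rfl⟩ | ⟨i, rfl⟩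
    · simp only [map_sub, map_mul, MvPolynomial.eval_X, key]
      ring
    · rw [eval_cubic]
      simp only [key]
      linear_combination (c * coordE Q j : ℂ) ^ 3 * coordE_equation P
    · rw [eval_cubic]
      simp only [key]
      linear_combination (c * coordE P i : ℂ) ^ 3 * coordE_equation Q
  · intro hv
    obtain ⟨⟨a, b⟩, hab⟩ := Function.ne_iff.mp v.rep_nonzero
    change v.rep (a, b) ≠ 0 at hab
    obtain ⟨P, c, hc⟩ := exists_coordE_eq (w := fun i => v.rep (i, b))
      (by linear_combination (eval_cubic _ _).symm.trans (hv _ (Or.inr (Or.inl ⟨b, rfl⟩))))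
    obtain ⟨Q, c', hc'⟩ := exists_coordE_eq (w := fun j => v.rep (a, j))
      (by linear_combination (eval_cubic _ _).symm.trans (hv _ (Or.inr (Or.inr ⟨a, rfl⟩))))
    refine ⟨(P, Q), ?_⟩
    -- A matrix whose 2 × 2 minors vanish is determined by the row and the column through a nonzero
    -- entry. Column b is proportional to P, row a to Q.
    have key : ∀ i j, v.rep (i, j) = c * c' / v.rep (a, b) * (coordE P i * coordE Q j) := by
      intro i j
      have h1 := hv _ (Or.inl ⟨i, j, a, b, rfl⟩)
      simp only [map_sub, map_mul, MvPolynomial.eval_X] at h1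
      have h2 := congrFun hc i
      have h3 := congrFun hc' j
      dsimp only at h2 h3
      rw [h2, h3] at h1
      field_simp
      linear_combination h1
    have hne : c * c' / v.rep (a, b) ≠ 0 := by
      intro h0
      rw [key, h0, zero_mul] at hab
      exact hab rfl
    rw [← v.mk_rep]
    refine (Projectivization.mk_eq_mk_iff' ℂ _ _ _ _).2 ⟨(c * c' / v.rep (a, b))⁻¹, ?_⟩
    funext ⟨i, j⟩
    rw [Pi.smul_apply, key i j, smul_eq_mul, inv_mul_cancel_left₀ hne]

theorem surface_isProjectiveVariety : surface.IsProjectiveVariety where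
  injective := surface_point_injective
  closed := by
    refine ⟨surfaceEquations, ?_, range_surface_point⟩
    rintro _ (⟨i, j, k, l, rfl⟩ | ⟨j, rfl⟩ | ⟨i, rfl⟩)
    · exact ⟨1 + 1, ((MvPolynomial.isHomogeneous_X _ _).mul (MvPolynomial.isHomogeneous_X _ _)).sub
        ((MvPolynomial.isHomogeneous_X _ _).mul (MvPolynomial.isHomogeneous_X _ _))⟩
    · exact ⟨3, cubic_isHomogeneous _⟩
    · exact ⟨3, cubic_isHomogeneous _⟩
  irreducible := ProjModel.irred_prod curve_irred curve_irred

/-! ### The diagonal -/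

theorem diag_closed : surface.Closed diag := by
  have h : surface.Open diagᶜ := by
    -- The diagonal is where the Segre matrix is symmetric, that is, where P and Q have proportional
    -- coordinates.
    have key := ProjModel.open_iUnion (X := surface) (ι := Fin 3 × Fin 3) fun a =>
      ProjModel.open_ne (X := surface) (d := 1)
        (p := MvPolynomial.X a - MvPolynomial.X (a.2, a.1))
        ((MvPolynomial.isHomogeneous_X _ _).sub (MvPolynomial.isHomogeneous_X _ _))
    convert key using 1
    ext ⟨P, Q⟩
    simp only [Set.mem_iUnion, Set.mem_ofPred_eq, map_sub, MvPolynomial.eval_X, sub_ne_zero]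
    constructor
    · intro hPQ
      by_contra! h
      exact hPQ (coordE_injective fun i j => h (i, j))
    · rintro ⟨a, ha⟩ hPQ
      obtain rfl : P = Q := hPQ
      exact ha (mul_comm _ _)
  let _ := surface.zariski
  exact isOpen_compl_iff.1 h

theorem diag_irred : surface.Irred diag := by
  let _ := curve.zariski
  let _ := surface.zariski
  have hc : Continuous fun P : curve.pts => (P, P) :=
    ⟨fun U hU => (ProjModel.isLocallyPolynomial_diag curve).open_preimage U hU⟩
  have h := IsIrreducible.image (f := fun P : curve.pts => ((P, P) : surface.pts)) curve_irred
    hc.continuousOn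
  have himage : (fun P : curve.pts => ((P, P) : surface.pts)) '' Set.univ = diag := by
    ext ⟨P, Q⟩
    simp [diag]
  rwa [himage] at h

theorem diag_inter_preperiodic_infinite :
    (diag ∩ ProjModel.preperiodicPoints selfMap).Infinite := by
  refine (infinite_torsion.image (f := fun P => (P, P))
    fun P _ Q _ h => congrArg Prod.fst h).mono ?_
  rintro _ ⟨P, ⟨N, hN, hP⟩, rfl⟩
  exact ⟨rfl, preperiodic_of_torsion hN hP⟩

/-- If the closure missed a point of the diagonal, its complement would pull back to a nonempty,
hence cofinite, open subset of E containing no torsion point. -/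
theorem zariskiClosure_preperiodic :
    surface.zariskiClosure (ProjModel.preperiodicPoints selfMap ∩ diag) = diag := by
  let _ := surface.zariski
  refine (closure_minimal Set.inter_subset_right diag_closed).antisymm ?_
  rintro ⟨P, Q⟩ hPQ
  obtain rfl : P = Q := hPQ
  by_contra hP
  have hopen : IsOpen (closure (ProjModel.preperiodicPoints selfMap ∩ diag : Set surface.pts))ᶜ :=
    isClosed_closure.isOpen_compl
  refine infinite_torsion ((compl_finite_of_open
    ((ProjModel.isLocallyPolynomial_diag curve).open_preimage _ hopen) ⟨P, hP⟩).subset ?_)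
  rintro Q ⟨N, hN, hQ⟩ hmem
  exact hmem (subset_closure ⟨preperiodic_of_torsion hN hQ, rfl⟩)

/-! ### The morphisms `[i]` and `[2 ± i]` -/

theorem isLocallyPolynomial_mulI :
    ProjModel.IsLocallyPolynomial (X := curve) (Y := curve) mulI :=
  ProjModel.isLocallyPolynomial_of_forall (X := curve) (Y := curve) (e := 1)
    (fun j => MvPolynomial.C ((![-1, I, 1] : Fin 3 → ℂ) j) * MvPolynomial.X j)
    (fun _ => MvPolynomial.isHomogeneous_C_mul_X _ _) fun P => by
      cases P with
      | zero =>
        refine ⟨-I, by simp, ?_⟩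
        funext j
        fin_cases j <;> simp [mulI, coordE]
      | some x y h =>
        refine ⟨1, one_ne_zero, ?_⟩
        funext j
        fin_cases j <;> simp [mulI, coordE]

/-- The quadratic form `Y² + XZ`, which equals `X³ / Z` on the curve. -/
def formT : MvPolynomial (Fin 3) ℂ :=
  MvPolynomial.X 1 ^ 2 + MvPolynomial.X 0 * MvPolynomial.X 2

theorem formT_isHomogeneous : formT.IsHomogeneous 2 :=
  (MvPolynomial.isHomogeneous_X_pow _ 2).add
    ((MvPolynomial.isHomogeneous_X _ _).mul (MvPolynomial.isHomogeneous_X _ _))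

/-- The quartic form which on the curve equals `(a X⁶ + b X⁴Z² + c X²Z⁴ + d Z⁶) / Z²`. -/
def quartic (a b c d : ℂ) : MvPolynomial (Fin 3) ℂ :=
  MvPolynomial.C a * formT ^ 2 + MvPolynomial.C b * MvPolynomial.X 0 ^ 4 +
    MvPolynomial.C c * (MvPolynomial.X 0 ^ 2 * MvPolynomial.X 2 ^ 2) +
    MvPolynomial.C d * MvPolynomial.X 2 ^ 4

theorem quartic_isHomogeneous (a b c d : ℂ) : (quartic a b c d).IsHomogeneous 4 :=
  (((formT_isHomogeneous.pow 2).C_mul a).add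
    ((MvPolynomial.isHomogeneous_X_pow _ 4).C_mul b) |>.add
    (((MvPolynomial.isHomogeneous_X_pow _ 2).mul (MvPolynomial.isHomogeneous_X_pow _ 2)).C_mul c)
    |>.add ((MvPolynomial.isHomogeneous_X_pow _ 4).C_mul d))

theorem eval_formT_some {x y : ℂ} (h : y ^ 2 = x ^ 3 - x) :
    MvPolynomial.eval ![x, y, 1] formT = x ^ 3 := by
  simp [formT, h]

theorem eval_quartic_some {x y : ℂ} (h : y ^ 2 = x ^ 3 - x) (a b c d : ℂ) :
    MvPolynomial.eval ![x, y, 1] (quartic a b c d) = a * x ^ 6 + b * x ^ 4 + c * x ^ 2 + d := by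
  simp only [quartic, map_add, map_mul, map_pow, MvPolynomial.eval_C, MvPolynomial.eval_X,
    eval_formT_some h, Matrix.cons_val_zero, Matrix.cons_val]
  ring

theorem eval_quartic_zero (a b c d : ℂ) :
    MvPolynomial.eval ![0, 1, 0] (quartic a b c d) = a := by
  simp [quartic, formT]

/-- The form that gives the `Y`-coordinate of `[2 + J]`, divided by `Y`. -/
def formC (J : ℂ) : MvPolynomial (Fin 3) ℂ :=
  quartic 1 (1 - 6 * J) (15 + 12 * J) (2 * J - 1)

/-- The forms of degree `5` that describe the map `[2 + J]`, for a square root `J` of `-1`. -/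
def quintic (J : ℂ) (j : Fin 3) : MvPolynomial (Fin 3) ℂ :=
  MvPolynomial.X j * (![quartic (2 + J) (-8 + 5 * J) (2 - 9 * J) (3 * J - 4), formC J,
    quartic (2 + 11 * J) (12 - 9 * J) (-6 - 3 * J) J] : Fin 3 → MvPolynomial (Fin 3) ℂ) j

theorem quintic_isHomogeneous (J : ℂ) (j : Fin 3) : (quintic J j).IsHomogeneous (1 + 4) := by
  refine (MvPolynomial.isHomogeneous_X _ _).mul ?_
  fin_cases j <;> exact quartic_isHomogeneous _ _ _ _

/-- The map `m` is given by the forms `quintic J`. -/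
def IsQuintic (J : ℂ) (m : E.Point → E.Point) : Prop :=
  ∀ P : E.Point, ∃ c : ℂ, c ≠ 0 ∧
    coordE (m P) = fun j => MvPolynomial.eval (coordE P) (quintic J j) * c

theorem IsQuintic.isLocallyPolynomial {J : ℂ} {m : E.Point → E.Point} (h : IsQuintic J m) :
    ProjModel.IsLocallyPolynomial (X := curve) (Y := curve) m :=
  ProjModel.isLocallyPolynomial_of_forall (X := curve) (Y := curve) _ (quintic_isHomogeneous J) h

/-- Homogenizing the affine formula directly gives forms of degree 7 that all vanish at the origin.
On E the relation X³/Z = Y² + XZ permits division by Z², leaving quintic forms that are valid at the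
origin too. -/
theorem eval_quintic_some {J x y : ℂ} (hJ : J ^ 2 = -1) (h : y ^ 2 = x ^ 3 - x) :
    (fun j => MvPolynomial.eval ![x, y, 1] (quintic J j)) =
      ![x * ((x ^ 2 - 1 + 2 * J) ^ 2 * ((2 + J) * x ^ 2 - J)),
        y * (x ^ 6 + (1 - 6 * J) * x ^ 4 + (15 + 12 * J) * x ^ 2 + (2 * J - 1)),
        ((2 + J) * x ^ 2 - J) ^ 3] := by
  funext j
  fin_cases j
  · simp only [quintic, map_mul, MvPolynomial.eval_X, Fin.zero_eta, Matrix.cons_val_zero,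
      eval_quartic_some h]
    grind
  · simp [quintic, formC, eval_quartic_some h]
  · simp only [quintic, map_mul, MvPolynomial.eval_X, Fin.reduceFinMk, Matrix.cons_val,
      eval_quartic_some h]
    grind

theorem isQuintic_of_forall_some {J : ℂ} (hJ : J ^ 2 = -1) {m : E.Point → E.Point} (h0 : m 0 = 0)
    (h : ∀ x y hxy, ∃ h', m (Point.some x y hxy) =
      Point.some x y hxy + (Point.some x y hxy + Point.some (-x) (J * y) h')) :
    IsQuintic J m := by
  intro P
  cases P with
  | zero =>
    refine ⟨1, one_ne_zero, ?_⟩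
    change coordE (m 0) = _
    rw [h0]
    funext j
    fin_cases j
    · simp [coordE, quintic]
    · simp [coordE, quintic, formC, eval_quartic_zero]
    · simp [coordE, quintic]
  | some x y hxy =>
    obtain ⟨h', hm⟩ := h x y hxy
    obtain ⟨c, hc, key⟩ := two_add_mulJ hJ hxy h'
    refine ⟨c, hc, ?_⟩
    rw [hm, key, ← eval_quintic_some hJ ((E_nonsingular_iff x y).1 hxy)]
    rfl

theorem isQuintic_two_one : IsQuintic I (mul ⟨2, 1⟩) := by
  refine isQuintic_of_forall_some I_sq (mulHom ⟨2, 1⟩).map_zero fun x y hxy =>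
    ⟨(E_nonsingular_iff _ _).2 ?_, ?_⟩
  · linear_combination y ^ 2 * I_sq - (E_nonsingular_iff x y).1 hxy
  · rw [mul, one_zsmul, two_zsmul, add_assoc]
    rfl

theorem isQuintic_two_neg_one : IsQuintic (-I) (mul ⟨2, -1⟩) := by
  refine isQuintic_of_forall_some (by rw [neg_sq, I_sq]) (mulHom ⟨2, -1⟩).map_zero fun x y hxy =>
    ⟨(E_nonsingular_iff _ _).2 ?_, ?_⟩
  · linear_combination y ^ 2 * I_sq - (E_nonsingular_iff x y).1 hxy
  · rw [mul, neg_one_zsmul, two_zsmul, add_assoc]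
    congr 2
    exact (Point.neg_some _).trans (some_congr rfl (by rw [E_negY, neg_mul]))

/-! ### The pullback of `𝒪(0)` by `[2 ± i]` -/

/-- Numerators of the isomorphism `[2 + J]^* 𝒪(0) ≅ 𝒪(5 · 0)`. -/
def pullbackNum (J : ℂ) : Bool → Bool → MvPolynomial (Fin 3) ℂ
  | false, false => MvPolynomial.C (2 + J) * MvPolynomial.X 0 ^ 2 -
      MvPolynomial.C J * MvPolynomial.X 2 ^ 2
  | false, true => MvPolynomial.X 0 * quartic (2 + J) (-J) 0 0
  | true, false => MvPolynomial.X 1 * formC J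
  | true, true => formT ^ 2 * formC J

/-- Denominators of the isomorphism `[2 + J]^* 𝒪(0) ≅ 𝒪(5 · 0)`. -/
def pullbackDen (J : ℂ) : Bool → Bool → MvPolynomial (Fin 3) ℂ
  | false, false => MvPolynomial.X 2 ^ 2
  | false, true => MvPolynomial.X 1 ^ 5
  | true, false => MvPolynomial.X 0 *
      (MvPolynomial.X 0 ^ 2 + MvPolynomial.C (2 * J - 1) * MvPolynomial.X 2 ^ 2) ^ 2
  | true, true => MvPolynomial.X 1 ^ 4 * quartic 1 (-2 + 4 * J) (-3 - 4 * J) 0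

theorem pullback_isHomogeneous (J : ℂ) (a i : Bool) :
    ∃ d, (pullbackNum J a i).IsHomogeneous d ∧ (pullbackDen J a i).IsHomogeneous d := by
  have hX (j : Fin 3) := MvPolynomial.isHomogeneous_X ℂ j
  have hXp (j : Fin 3) (n : ℕ) := MvPolynomial.isHomogeneous_X_pow (R := ℂ) j n
  match a, i with
  | false, false => exact ⟨2, ((hXp 0 2).C_mul _).sub ((hXp 2 2).C_mul _), hXp 2 2⟩
  | false, true => exact ⟨5, (hX 0).mul (quartic_isHomogeneous _ _ _ _), hXp 1 5⟩
  | true, false =>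
    exact ⟨5, (hX 1).mul (quartic_isHomogeneous _ _ _ _),
      (hX 0).mul (((hXp 0 2).add ((hXp 2 2).C_mul _)).pow 2)⟩
  | true, true =>
    exact ⟨8, (formT_isHomogeneous.pow 2).mul (quartic_isHomogeneous _ _ _ _),
      (hXp 1 4).mul (quartic_isHomogeneous _ _ _ _)⟩

/-- Local expressions, at an affine point, of the isomorphism `[2 + J]^* 𝒪(0) ≅ 𝒪(5 · 0)`. -/
def pullbackVal (x y A B C : ℂ) : Bool → Bool → ℂ × ℂ
  | false, false => (B, 1)
  | false, true => (x ^ 5 * B, y ^ 5)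
  | true, false => (y * C, x * A ^ 2)
  | true, true => (x ^ 6 * C, y ^ 4 * (x ^ 2 * A ^ 2))

/-- All four quotients express multiplication by B: the target chart at the origin contributes
(x/y)^5, and the source chart divides by the value of X/Y at [2+J]P. In the last case both terms
carry an extra x², so that their pole order at the origin is 24 = 3 · 8 and the forms of degree 8 do
not vanish there. -/
theorem eval_pullback_some {J x y : ℂ} (hJ : J ^ 2 = -1) (h : y ^ 2 = x ^ 3 - x) (a i : Bool) :
    (MvPolynomial.eval ![x, y, 1] (pullbackNum J a i),
      MvPolynomial.eval ![x, y, 1] (pullbackDen J a i)) =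
    pullbackVal x y (x ^ 2 - 1 + 2 * J) ((2 + J) * x ^ 2 - J)
      (x ^ 6 + (1 - 6 * J) * x ^ 4 + (15 + 12 * J) * x ^ 2 + (2 * J - 1)) a i := by
  cases a <;> cases i <;> refine Prod.ext ?_ ?_ <;>
    simp [pullbackNum, pullbackDen, pullbackVal, formC, eval_quartic_some h, eval_formT_some h,
      -mul_eq_mul_left_iff, -mul_eq_mul_right_iff]
  · ring
  · ring
  · ring
  · linear_combination -4 * x ^ 2 * y ^ 4 * hJ

/-- Membership in the trivializing sets at an affine point forces the relevant quantities to be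
nonzero. -/
theorem pullback_nonvanishing {J : ℂ} (hJ : J ^ 2 = -1) {m : E.Point → E.Point}
    (hm : IsQuintic J m) {x y : ℂ} (h : E.Nonsingular x y) {a i : Bool}
    (ha : m (Point.some x y h) ∈ originU a) (hi : Point.some x y h ∈ originU i) :
    (a = false → (2 + J) * x ^ 2 - J ≠ 0) ∧
    (a = true → x ≠ 0 ∧ y ≠ 0 ∧ x ^ 2 - 1 + 2 * J ≠ 0 ∧
      x ^ 6 + (1 - 6 * J) * x ^ 4 + (15 + 12 * J) * x ^ 2 + (2 * J - 1) ≠ 0) ∧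
    (i = true → x ≠ 0 ∧ y ≠ 0) := by
  have hE := (E_nonsingular_iff x y).1 h
  have hy : y ≠ 0 → x ≠ 0 := by
    rintro hy rfl
    exact hy (by simpa using hE)
  obtain ⟨c, hc, hcoord⟩ := hm (Point.some x y h)
  have hcoord' : coordE (m (Point.some x y h)) = fun j => _ := hcoord.trans (by
    funext j
    exact congrArg (· * c) (congrFun (eval_quintic_some hJ hE) j))
  refine ⟨?_, ?_, ?_⟩
  · rintro rfl
    change coordE _ 2 ≠ 0 at ha
    rw [hcoord'] at ha
    intro h0
    simp [h0] at ha
  · rintro rfl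
    change coordE _ 1 ≠ 0 at ha
    rw [hcoord'] at ha
    replace ha := left_ne_zero_of_mul ha
    simp only [Matrix.cons_val_one, Matrix.cons_val_zero] at ha
    have hy' := left_ne_zero_of_mul ha
    have hC := right_ne_zero_of_mul ha
    refine ⟨hy hy', hy', fun h0 => hC ?_, hC⟩
    -- The sextic is a multiple of A = x² - 1 + 2J modulo J² + 1. Geometrically, A = 0 means that
    -- [2+J]P has abscissa 0, so its ordinate is 0 as well.
    linear_combination (x ^ 4 + (2 - 8 * J) * x ^ 2 + 1) * h0 + 16 * x ^ 2 * hJ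
  · rintro rfl
    have hi' : y ≠ 0 := hi
    exact ⟨hy hi', hi'⟩

theorem originG_pullback_some {J : ℂ} (hJ : J ^ 2 = -1) {m : E.Point → E.Point}
    (hm : IsQuintic J m) {x y : ℂ} (h : E.Nonsingular x y) (a b : Bool) :
    originG a b (m (Point.some x y h)) = match a, b with
      | true, false => x * ((x ^ 2 - 1 + 2 * J) ^ 2 * ((2 + J) * x ^ 2 - J)) /
          (y * (x ^ 6 + (1 - 6 * J) * x ^ 4 + (15 + 12 * J) * x ^ 2 + (2 * J - 1)))
      | false, true => y * (x ^ 6 + (1 - 6 * J) * x ^ 4 + (15 + 12 * J) * x ^ 2 + (2 * J - 1)) /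
          (x * ((x ^ 2 - 1 + 2 * J) ^ 2 * ((2 + J) * x ^ 2 - J)))
      | _, _ => 1 := by
  have hE := (E_nonsingular_iff x y).1 h
  obtain ⟨c, hc, hcoord⟩ := hm (Point.some x y h)
  have hj (j : Fin 3) := (congrFun hcoord j).trans
    (congrArg (· * c) (congrFun (eval_quintic_some hJ hE) j))
  cases a <;> cases b <;> simp only [originG, hj] <;> rw [mul_div_mul_right _ _ hc] <;> rfl

theorem not_mem_pullback_zero {J : ℂ} {m : E.Point → E.Point} (hm : IsQuintic J m) {a i : Bool}
    (ha : m Point.zero ∈ originU a) (hi : Point.zero ∈ originU i) : a = true ∧ i = true := by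
  constructor
  · by_contra h0
    obtain ⟨c, hc, hcoord⟩ := hm Point.zero
    rw [Bool.not_eq_true] at h0
    subst h0
    change coordE _ 2 ≠ 0 at ha
    rw [hcoord] at ha
    simp [quintic, coordE] at ha
  · by_contra h0
    rw [Bool.not_eq_true] at h0
    subst h0
    exact hi rfl

theorem eval_pullback_zero (J : ℂ) :
    MvPolynomial.eval ![0, 1, 0] (pullbackNum J true true) = 1 ∧
      MvPolynomial.eval ![0, 1, 0] (pullbackDen J true true) = 1 := by
  simp [pullbackNum, pullbackDen, formC, eval_quartic_zero, formT]

theorem eval_pullback_ne_zero {J : ℂ} (hJ : J ^ 2 = -1) {m : E.Point → E.Point}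
    (hm : IsQuintic J m) {P : E.Point} {a i : Bool} (ha : m P ∈ originU a) (hi : P ∈ originU i) :
    MvPolynomial.eval (coordE P) (pullbackNum J a i) ≠ 0 ∧
      MvPolynomial.eval (coordE P) (pullbackDen J a i) ≠ 0 := by
  cases P with
  | zero =>
    obtain ⟨rfl, rfl⟩ := not_mem_pullback_zero hm ha hi
    have h := eval_pullback_zero J
    exact ⟨h.1.trans_ne one_ne_zero, h.2.trans_ne one_ne_zero⟩
  | some x y h =>
    obtain ⟨h1, h2, h3⟩ := pullback_nonvanishing hJ hm h ha hi
    have hval := Prod.ext_iff.1 (eval_pullback_some hJ ((E_nonsingular_iff x y).1 h) a i)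
    refine ⟨hval.1.trans_ne ?_, hval.2.trans_ne ?_⟩ <;> cases a <;> cases i <;>
      simp_all [pullbackVal]

theorem pullback_compat {J : ℂ} (hJ : J ^ 2 = -1) {m : E.Point → E.Point} (hm : IsQuintic J m)
    {P : E.Point} {a b i j : Bool} (ha : m P ∈ originU a) (hb : m P ∈ originU b)
    (hi : P ∈ originU i) (hj : P ∈ originU j) :
    MvPolynomial.eval (coordE P) (pullbackNum J b j) /
        MvPolynomial.eval (coordE P) (pullbackDen J b j) =
      originG j i P ^ 5 * (MvPolynomial.eval (coordE P) (pullbackNum J a i) /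
        MvPolynomial.eval (coordE P) (pullbackDen J a i)) * originG a b (m P) := by
  cases P with
  | zero =>
    obtain ⟨rfl, rfl⟩ := not_mem_pullback_zero hm ha hi
    obtain ⟨rfl, rfl⟩ := not_mem_pullback_zero hm hb hj
    simp [originG]
  | some x y h =>
    have hE := (E_nonsingular_iff x y).1 h
    obtain ⟨ha1, ha2, hi3⟩ := pullback_nonvanishing hJ hm h ha hi
    obtain ⟨hb1, hb2, hj3⟩ := pullback_nonvanishing hJ hm h hb hj
    have hnum (a i : Bool) := congrArg Prod.fst (eval_pullback_some hJ hE a i)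
    have hden (a i : Bool) := congrArg Prod.snd (eval_pullback_some hJ hE a i)
    dsimp only at hnum hden
    rw [originG_pullback_some hJ hm h a b, show coordE (Point.some x y h) = ![x, y, 1] from rfl,
      hnum, hnum, hden, hden]
    clear hnum hden ha hb hi hj hm hE
    -- From here on the compatibility is an identity of rational monomials in x, y, A, B, C; neither
    -- the curve nor J² = -1 is needed.
    generalize (2 + J) * x ^ 2 - J = B at *
    generalize x ^ 6 + (1 - 6 * J) * x ^ 4 + (15 + 12 * J) * x ^ 2 + (2 * J - 1) = C at *
    generalize x ^ 2 - 1 + 2 * J = A at *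
    cases a <;> cases b <;> cases i <;> cases j <;>
      simp_all [pullbackVal, originG, coordE] <;> (try casesm* _ ∧ _) <;> field_simp

/-- The isomorphism `[2 + J]^* 𝒪(0) ≅ 𝒪(0) ^ 5`, for a square root `J` of `-1`. -/
def pullbackIso {J : ℂ} (hJ : J ^ 2 = -1) (f : ProjModel.Hom curve curve)
    (hm : IsQuintic J f.toFun) :
    ProjModel.LineBundle.Iso (ProjModel.LineBundle.pullback f originBundle)
      (originBundle.pow 5) where
  h a i P := MvPolynomial.eval (coordE P) (pullbackNum J a i) /
    MvPolynomial.eval (coordE P) (pullbackDen J a i)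
  regular a i P ha hi := by
    obtain ⟨d, hn, hd⟩ := pullback_isHomogeneous J a i
    exact curve.regularAt_div hn hd (eval_pullback_ne_zero hJ hm ha hi).2
  ne_zero a i P ha hi :=
    div_ne_zero (eval_pullback_ne_zero hJ hm ha hi).1 (eval_pullback_ne_zero hJ hm ha hi).2
  compat a b i j P ha hb hi hj := pullback_compat hJ hm ha hb hi hj

/-! ### The polarization -/

/-- Local expressions of `𝒪(1) ≅ 𝒪(3 · 0)`: a linear form is sent to its quotient by `Z`. -/
def hyperplaneNum (i : Fin 3) : Bool → MvPolynomial (Fin 3) ℂ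
  | false => MvPolynomial.X i
  | true => MvPolynomial.X i * formT

/-- Denominators of the local expressions of `𝒪(1) ≅ 𝒪(3 · 0)`. -/
def hyperplaneDen : Bool → MvPolynomial (Fin 3) ℂ
  | false => MvPolynomial.X 2
  | true => MvPolynomial.X 1 ^ 3

theorem hyperplane_isHomogeneous (i : Fin 3) (b : Bool) :
    ∃ d, (hyperplaneNum i b).IsHomogeneous d ∧ (hyperplaneDen b).IsHomogeneous d := by
  cases b with
  | false => exact ⟨1, MvPolynomial.isHomogeneous_X _ _, MvPolynomial.isHomogeneous_X _ _⟩
  | true => exact ⟨1 + 2, (MvPolynomial.isHomogeneous_X _ _).mul formT_isHomogeneous,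
      MvPolynomial.isHomogeneous_X_pow _ 3⟩

theorem eval_hyperplaneDen_ne_zero {P : E.Point} {b : Bool} (h : P ∈ originU b) :
    MvPolynomial.eval (coordE P) (hyperplaneDen b) ≠ 0 := by
  cases b with
  | false =>
    have h' : coordE P 2 ≠ 0 := h
    simpa [hyperplaneDen] using h'
  | true =>
    have h' : coordE P 1 ≠ 0 := h
    simpa [hyperplaneDen] using h'

theorem formT_mul_eq (P : E.Point) :
    MvPolynomial.eval (coordE P) formT * coordE P 2 = coordE P 0 ^ 3 := by
  simp only [formT, map_add, map_mul, map_pow, MvPolynomial.eval_X]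
  linear_combination coordE_equation P

theorem eval_formT_ne_zero {P : E.Point} (h : P ∈ originU true) :
    MvPolynomial.eval (coordE P) formT ≠ 0 := by
  intro h0
  have h1 : coordE P 1 ≠ 0 := h
  have h2 := formT_mul_eq P
  rw [h0, zero_mul, eq_comm, pow_eq_zero_iff (by norm_num)] at h2
  simp [formT, h2, h1] at h0

theorem eval_hyperplaneNum_ne_zero {P : E.Point} {i : Fin 3} {b : Bool} (hi : coordE P i ≠ 0)
    (h : P ∈ originU b) : MvPolynomial.eval (coordE P) (hyperplaneNum i b) ≠ 0 := by
  cases b with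
  | false => simpa [hyperplaneNum] using hi
  | true => simpa [hyperplaneNum, hi] using eval_formT_ne_zero h

theorem hyperplane_compat {P : E.Point} {i j : Fin 3} {a b : Bool} (hi : coordE P i ≠ 0)
    (ha : P ∈ originU a) (hb : P ∈ originU b) :
    MvPolynomial.eval (coordE P) (hyperplaneNum j b) /
        MvPolynomial.eval (coordE P) (hyperplaneDen b) =
      originG b a P ^ 3 * (MvPolynomial.eval (coordE P) (hyperplaneNum i a) /
        MvPolynomial.eval (coordE P) (hyperplaneDen a)) * (coordE P j / coordE P i) := by
  have hT := formT_mul_eq P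
  cases a <;> cases b <;> simp only [hyperplaneNum, hyperplaneDen, originG, map_mul, map_pow,
    MvPolynomial.eval_X]
  · field_simp
  · have h2 : coordE P 2 ≠ 0 := ha
    have h1 : coordE P 1 ≠ 0 := hb
    field_simp
    linear_combination coordE P j * hT
  · have h2 : coordE P 2 ≠ 0 := hb
    have h1 : coordE P 1 ≠ 0 := ha
    have h0 := coordE_zero_ne h2 h1
    field_simp
    linear_combination -coordE P j * hT
  · field_simp

/-- The isomorphism `𝒪(1) ≅ 𝒪(0) ^ 3` on the plane cubic `E`. -/
def hyperplaneIso :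
    ProjModel.LineBundle.Iso (ProjModel.LineBundle.hyperplane curve) (originBundle.pow 3) where
  h i b P := MvPolynomial.eval (coordE P) (hyperplaneNum i b) /
    MvPolynomial.eval (coordE P) (hyperplaneDen b)
  regular i b P hi hb := by
    obtain ⟨d, hn, hd⟩ := hyperplane_isHomogeneous i b
    exact curve.regularAt_div hn hd (eval_hyperplaneDen_ne_zero hb)
  ne_zero i b P hi hb :=
    div_ne_zero (eval_hyperplaneNum_ne_zero hi hb) (eval_hyperplaneDen_ne_zero hb)
  compat i j a b P hi hj ha hb := hyperplane_compat hi ha hb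

/-- The cube is already very ample: it is 𝒪(1) for the Segre embedding of two plane cubics, whose
hyperplane class is 3·(0) because the origin is a flex. -/
theorem polarization_isAmple : polarization.IsAmple :=
  ⟨3, by norm_num, surface, surface_isProjectiveVariety, ProjModel.Iso.refl surface,
    ⟨ProjModel.LineBundle.Iso.hyperplaneBoxPow hyperplaneIso hyperplaneIso⟩⟩

/-- The product of two maps `[2 ± i]`, as a morphism. -/
def quinticProd {J J' : ℂ} {m m' : E.Point → E.Point} (hm : IsQuintic J m)
    (hm' : IsQuintic J' m') : ProjModel.Hom surface surface :=
  (hm.isLocallyPolynomial.prodMap hm'.isLocallyPolynomial).toHom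

/-- The pullback of the polarization by a product of two maps `[2 ± i]` is its fifth power. -/
def polarizationIso {J J' : ℂ} (hJ : J ^ 2 = -1) (hJ' : J' ^ 2 = -1) {m m' : E.Point → E.Point}
    (hm : IsQuintic J m) (hm' : IsQuintic J' m') :
    ProjModel.LineBundle.Iso (ProjModel.LineBundle.pullback (quinticProd hm hm') polarization)
      (polarization.pow 5) :=
  ProjModel.LineBundle.Iso.boxPow (pullbackIso hJ hm.isLocallyPolynomial.toHom hm)
    (pullbackIso hJ' hm'.isLocallyPolynomial.toHom hm') _ rfl

/-! ### The dynamical system and the counterexample -/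

/-- The morphism `([3 + 4i], [5])`, written as `([2 + i], [2 + i]) ∘ ([2 + i], [2 - i])`. -/
def selfHom : ProjModel.Hom surface surface :=
  (quinticProd isQuintic_two_one isQuintic_two_one).comp
    (quinticProd isQuintic_two_one isQuintic_two_neg_one)

theorem selfHom_toFun : selfHom.toFun = selfMap := by
  funext ⟨P, Q⟩
  have h1 : mul ⟨2, 1⟩ (mul ⟨2, 1⟩ P) = mul ⟨3, 4⟩ P := by
    rw [← mul_mul]
    rfl
  have h2 : mul ⟨2, 1⟩ (mul ⟨2, -1⟩ Q) = mul 5 Q := by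
    rw [← mul_mul]
    rfl
  exact Prod.ext h1 h2

theorem selfHom_isPolarized :
    ProjModel.IsPolarizedOfWeight selfHom polarization (5 ^ 2) where
  variety := surface_isProjectiveVariety
  ample := polarization_isAmple
  two_le := by norm_num
  iso := by
    have hI : (-I) ^ 2 = -1 := by rw [neg_sq, I_sq]
    -- With f = h ∘ g, `α` is g^*(h^*ℒ) ≅ g^*(ℒ^5) and `β` is (g^*ℒ)^5 ≅ (ℒ^5)^5. They compose
    -- because pullback commutes with powers, and with composition of morphisms, by definition.
    have α := (polarizationIso I_sq I_sq isQuintic_two_one isQuintic_two_one).pullback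
      (quinticProd isQuintic_two_one isQuintic_two_neg_one)
    have β := (polarizationIso I_sq hI isQuintic_two_one isQuintic_two_neg_one).pow 5
    exact ⟨(α.trans β).trans (polarization.powMul 5 5)⟩

theorem not_maninMumfordFor_diag : ¬ ProjModel.ManinMumfordFor selfHom diag := by
  intro h
  refine not_isPreperiodicSubvariety_diag ?_
  rw [← selfHom_toFun]
  refine h diag ?_
  rw [selfHom_toFun, zariskiClosure_preperiodic]
  exact ⟨⟨diag_irred, subset_rfl⟩, fun T hT _ => hT.2⟩

end GhiocaTucker

end

theorem mainTheorem12 :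
    (∃ φ : GaussianInt →+* AddMonoid.End GhiocaTucker.E.Point, Function.Injective φ ∧
      ∀ (a : GaussianInt) (P : GhiocaTucker.E.Point), φ a P = GhiocaTucker.mul a P) ∧
    (∃ h : ProjModel.Hom GhiocaTucker.curve GhiocaTucker.curve,
      h.toFun = GhiocaTucker.mul ⟨0, 1⟩) ∧
    ∃ f : ProjModel.Hom GhiocaTucker.surface GhiocaTucker.surface,
      f.toFun = GhiocaTucker.selfMap ∧
      ‖(3 + 4 * Complex.I : ℂ)‖ ^ 2 = 5 ^ 2 ∧
      ProjModel.IsPolarizedOfWeight f GhiocaTucker.polarization (5 ^ 2) ∧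
      GhiocaTucker.surface.Closed GhiocaTucker.diag ∧
      GhiocaTucker.surface.Irred GhiocaTucker.diag ∧
      (GhiocaTucker.diag ∩ ProjModel.preperiodicPoints f.toFun).Infinite ∧
      ¬ ProjModel.IsPreperiodicSubvariety f.toFun GhiocaTucker.diag ∧
      (∀ n : ℕ, 1 ≤ n → ((3 + 4 * Complex.I) / 5 : ℂ) ^ n ≠ 1) ∧
      ¬ ProjModel.ManinMumfordFor f GhiocaTucker.diag ∧
      ¬ DynamicalManinMumford := by
  refine ⟨⟨GhiocaTucker.mulHom, GhiocaTucker.mulHom_injective, GhiocaTucker.mulHom_apply⟩,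
    ⟨GhiocaTucker.isLocallyPolynomial_mulI.toHom,
      funext fun P => (GhiocaTucker.mul_zero_one P).symm⟩,
    GhiocaTucker.selfHom, GhiocaTucker.selfHom_toFun, ?_, GhiocaTucker.selfHom_isPolarized,
    GhiocaTucker.diag_closed, GhiocaTucker.diag_irred, ?_, ?_,
    fun n => GhiocaTucker.three_add_four_I_div_pow_ne_one,
    GhiocaTucker.not_maninMumfordFor_diag, fun h => GhiocaTucker.not_maninMumfordFor_diag
      (h ℂ _ _ _ _ GhiocaTucker.selfHom_isPolarized _ GhiocaTucker.diag_closed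
        GhiocaTucker.diag_irred)⟩
  · rw [← Complex.normSq_eq_norm_sq, Complex.normSq_apply]
    norm_num
  · rw [GhiocaTucker.selfHom_toFun]
    exact GhiocaTucker.diag_inter_preperiodic_infinite
  · rw [GhiocaTucker.selfHom_toFun]
    exact GhiocaTucker.not_isPreperiodicSubvariety_diag
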